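/- Setting. Let $U$ be a random element of a measurable space $\mathscr U$ and $H:(0,\infty)\times\mathscr U\to\mathbb R^d$ a measurable map such that $r\mapsto\|H(r,u)\|$ is nonincreasing for every $u$. Write $\mathbb R^d_0=\mathbb R^d\setminus\{0\}$ and suppose that $\nu(B)=\int_0^\infty\mathbb P(H(r,U)\in B)\,dr$, $B\in\mathcal B(\mathbb R^d_0)$, is a Lévy measure, i.e. $\int(1\wedge\|\mathbf z\|^2)\,\nu(d\mathbf z)<\infty$. For $m\in\mathbb N$ put $\nu_m(B)=\int_0^m\mathbb P(H(r,U)\in B)\,dr$, so that $(\nu-\nu_m)(B)=\int_m^\infty\mathbb P(H(r,U)\in B)\,dr$. Let $(\mathcal T_n)_{n}$ be a nondecreasing sequence of intervals of finite length in $\mathbb R$ and $\mathcal T=\bigcup_n\mathcal T_n$. Let $\mu$ be a Poisson random measure on $\mathbb R_0^d\times\mathcal T$ with intensity $\nu(d\mathbf z)ds$ and, for each $m$, let $\mu=\mu_m+(\mu-\mu_m)$, where $\mu_m$ and $\mu-\mu_m$ are Poisson random measures with intensities $\nu_m(d\mathbf z)ds$ and $(\nu-\nu_m)(d\mathbf z)ds$.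 Let $T\in\mathbb R$, and for $t\in[0,T]$ let $f(t,\cdot):\mathcal T\to\mathbb R^{d\times d}$ be measurable. Define, for $t\in[0,T]$, $$Q_t(m)=\int_{\mathcal T}\int_{\mathbb R_0^d}f(t,s)\mathbf z\,\bigl((\mu-\mu_m)-(\nu-\nu_m)\mathbf 1_{(0,1]}(\|\mathbf z\|)\bigr)(d\mathbf z,ds),$$ $$R_t(m,n)=\int_{\mathcal T\setminus\mathcal T_n}\int_{\mathbb R_0^d}f(t,s)\mathbf z\,\bigl(\mu_m-\nu_m\mathbf 1_{(0,1]}(\|\mathbf z\|)\bigr)(d\mathbf z,ds).$$ It is assumed that these stochastic integrals exist for all $t\in[0,T]$, $m$ and $n$, where $m=0$, with $\nu_0=0$ and $Q_t(0)=X_t=\int_{\mathcal T}f(t,s)\,dL_s$, is included. Here the integral $\int_S\int f(s)\mathbf z\,(M-\lambda\mathbf 1_{(0,1]}(\|\mathbf z\|))(d\mathbf z,ds)$ against a Poisson random measure $M$ with intensity $\lambda(d\mathbf z)ds$ is said to exist if $\int_S\int(1\wedge\|f(s)\mathbf z\|^2)\,\lambda(d\mathbf z)ds<\infty$ and $\int_S\|b(s)\|ds<\infty$,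 where $b(s)=\int\bigl(f(s)\mathbf z\mathbf 1_{\{\|f(s)\mathbf z\|\le1\}}-f(s)\mathbf z\mathbf 1_{\{\|\mathbf z\|\le1\}}\bigr)\lambda(d\mathbf z)$; it is the limit in probability, as $\varepsilon\downarrow0$, of $$\int\!\!\int_{s\in S,\ \|f(s)\mathbf z\|>\varepsilon}f(s)\mathbf z\,M(d\mathbf z,ds)-\int\!\!\int_{s\in S,\ \varepsilon<\|f(s)\mathbf z\|\le1}f(s)\mathbf z\,\lambda(d\mathbf z)ds+\int_S b(s)\,ds .$$ Proposition. Assume that (a) $\operatorname{ess\,sup}_{s\in\mathcal T}\|f(t,s)\|<\infty$ for every $t\in[0,T]$; (b) $\int_{\mathcal T}\|f(t,s)\|^2ds<\infty$ for every $t\in[0,T]$; (c) $\lim_{m\to\infty}\int_m^\infty\mathbb E\|H(r,U)\|^2dr=0$. Then the processes $\{Q_t(m):t\in[0,T]\}$ and $\{R_t(m,n):t\in[0,T]\}$ are well defined (the limits in probability above exist), and they converge to the zero process on $[0,T]$ in the sense of finite dimensional distributions, as $m\to\infty$ and as $m\wedge n\to\infty$ respectively. -/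

import Mathlib

open MeasureTheory ProbabilityTheory Filter Topology Set
open scoped ENNReal NNReal

noncomputable section

/-- A Lévy measure: no mass at the origin and `∫ (1 ∧ ‖z‖²) ν(dz) < ∞`. -/
structure IsLevyMeasure {E : Type*} [NormedAddCommGroup E] [MeasurableSpace E]
    (ν : Measure E) : Prop where
  zero : ν {0} = 0
  lintegral_lt_top : ∫⁻ z, min 1 (‖z‖ₑ ^ 2) ∂ν < ∞

/-- The measure `B ↦ ∫_J ℙ(H(r, U) ∈ B) dr` on the punctured space `E ∖ {0}`
(seen as a measure on `E` without mass at `0`). -/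
def shotNoiseMeasure {Ω 𝒰 E : Type*} [MeasurableSpace Ω] [NormedAddCommGroup E]
    [MeasurableSpace E] (P : Measure Ω) (U : Ω → 𝒰) (H : ℝ → 𝒰 → E) (J : Set ℝ) : Measure E :=
  (((volume.restrict J).prod P).map (fun p : ℝ × Ω => H p.1 (U p.2))).restrict {0}ᶜ

/-- `M` is a Poisson random measure on `X` with intensity measure `Λ`, under `P`. -/
structure IsPoissonRandomMeasure {Ω X : Type*} [MeasurableSpace Ω] [MeasurableSpace X]
    (P : Measure Ω) (M : Ω → Measure X) (Λ : Measure X) : Prop where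
  measurable : Measurable M
  map_eq : ∀ B : Set X, MeasurableSet B → Λ B < ∞ →
    P.map (fun ω => M ω B) =
      (poissonMeasure (Λ B).toNNReal).map (fun k : ℕ => (k : ℝ≥0∞))
  ae_eq_top : ∀ B : Set X, MeasurableSet B → Λ B = ∞ → ∀ᵐ ω ∂P, M ω B = ∞
  iIndepFun : ∀ (k : ℕ) (B : Fin k → Set X), (∀ i, MeasurableSet (B i)) →
    Pairwise (fun i j => Disjoint (B i) (B j)) →
    iIndepFun (fun i ω => M ω (B i)) P

section StochasticIntegral

variable {Ω E : Type*} [MeasurableSpace Ω] [NormedAddCommGroup E] [NormedSpace ℝ E]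
  [MeasurableSpace E]

/-- The function `A ↦ ∫ (A z 1_{‖A z‖ ≤ 1} - A z 1_{‖z‖ ≤ 1}) ν(dz)`: the change of drift when the
compensator `1_{‖z‖ ≤ 1}`, which looks at the jump `z` of the integrator, is replaced by
`1_{‖A z‖ ≤ 1}`, which looks at the jump `A z` of the integral. -/
def driftChange (ν : Measure E) (A : E →L[ℝ] E) : E :=
  ∫ z, (({z : E | ‖A z‖ ≤ 1}.indicator (fun z => A z) z)
    - ({z : E | ‖z‖ ≤ 1}.indicator (fun z => A z) z)) ∂ν

/-- The (Rajput–Rosiński) conditions for the existence of the stochastic integral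
`∫_S ∫ f(s) z (M(dz, ds) - 1_{‖z‖ ≤ 1} ν(dz) ds)`. -/
structure PoissonIntegrable (ν : Measure E) (S : Set ℝ) (f : ℝ → E →L[ℝ] E) : Prop where
  jumps : ∫⁻ s in S, ∫⁻ z, min 1 (‖f s z‖ₑ ^ 2) ∂ν < ∞
  drift : ∫⁻ s in S, ‖driftChange ν (f s)‖ₑ < ∞

/-- The stochastic integral of `f` without the jumps of the integral of size at most `ε`:
`∫∫_{‖f(s) z‖ > ε} f(s) z M(dz, ds) - ∫∫_{ε < ‖f(s) z‖ ≤ 1} f(s) z ν(dz) ds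
  + ∫∫ (f(s) z 1_{‖f(s) z‖ ≤ 1} - f(s) z 1_{‖z‖ ≤ 1}) ν(dz) ds`,
each over `s ∈ S`. -/
def truncatedPoissonIntegral (M : Ω → Measure (E × ℝ)) (ν : Measure E) (S : Set ℝ)
    (f : ℝ → E →L[ℝ] E) (ε : ℝ) (ω : Ω) : E :=
  (∫ p in {p : E × ℝ | p.2 ∈ S ∧ ε < ‖f p.2 p.1‖}, f p.2 p.1 ∂(M ω))
    - (∫ p in {p : E × ℝ | p.2 ∈ S ∧ ε < ‖f p.2 p.1‖ ∧ ‖f p.2 p.1‖ ≤ 1},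
        f p.2 p.1 ∂(ν.prod volume))
    + ∫ s in S, driftChange ν (f s)

/-- `Y` is (a version of) the stochastic integral
`∫_S ∫ f(s) z (M(dz, ds) - 1_{‖z‖ ≤ 1} ν(dz) ds)`, where `M` is a Poisson random measure whose
intensity is `ν(dz) ds` on `E × S`: the existence conditions hold, and `Y` is the limit in
probability of the truncated integrals as `ε ↓ 0`. -/
structure IsPoissonIntegral (P : Measure Ω) (M : Ω → Measure (E × ℝ)) (ν : Measure E)
    (S : Set ℝ) (f : ℝ → E →L[ℝ] E) (Y : Ω → E) : Prop where
  integrable : PoissonIntegrable ν S f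
  aemeasurable : AEMeasurable Y P
  tendsto : TendstoInMeasure P (fun (ε : ℝ) ω => truncatedPoissonIntegral M ν S f ε ω) (𝓝[>] 0) Y

open Classical in
/-- The stochastic integral `∫_S ∫ f(s) z (M(dz, ds) - 1_{‖z‖ ≤ 1} ν(dz) ds)`
(with value `0` where it does not exist). -/
def poissonIntegral (P : Measure Ω) (M : Ω → Measure (E × ℝ)) (ν : Measure E)
    (S : Set ℝ) (f : ℝ → E →L[ℝ] E) : Ω → E :=
  if h : ∃ Y : Ω → E, IsPoissonIntegral P M ν S f Y then h.choose else 0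

end StochasticIntegral

/-- The processes `Z j = (Z j t)_t` converge along `l` to the process `W`, over the time set `I`,
in the sense of finite dimensional distributions. -/
def TendstoInFDD {Ω E ι : Type*} [MeasurableSpace Ω] [TopologicalSpace E] [MeasurableSpace E]
    [BorelSpace E] [SecondCountableTopology E]
    (P : Measure Ω) [IsProbabilityMeasure P] (I : Set ℝ)
    (Z : ι → ℝ → Ω → E) (l : Filter ι) (W : ℝ → Ω → E) : Prop :=
  ∀ (k : ℕ) (t : Fin k → ℝ), (∀ i, t i ∈ I) →
    TendstoInDistribution (fun j ω (i : Fin k) => Z j (t i) ω) l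
      (fun ω (i : Fin k) => W (t i) ω) (fun _ => P) P

end

/-! After truncation at `ε`, a Poisson integral is a compensated sum of jumps of size in `(ε, 1]`,
plus the sum of the jumps larger than `1`, plus a deterministic drift. Let `J` be the integral of `1
∧ ‖f(s) z‖²` against the intensity. The second moment of the compensated part is at most `J`, and a
large jump occurs with probability at most `J`. So if the `L¹` norm of the drift is below `η`, then
`P(‖Y‖ ≥ 3η) ≤ J + J / η²` (`IsPoissonIntegral.measure_ge_le`). The same second moment bound makes
the truncated integrals `L²`-Cauchy, which gives existence. It remains to send `J` and the drift to
zero.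

For `Q`, `J` is at most `∫ ‖f‖²` times the second moment of `ν - ν_m`, which vanishes by (c). Up to
an error of the same order, the drift is `f(s) c_m` with `c_m = ∫_{‖z‖ > 1} z (ν - ν_m)(dz)`. Here
`c_m → 0`, but `f` need not be in `L¹`. Existence of the integral rescues the argument: it forces
`f(·) c_m` to be in `L¹`, and on the finite dimensional space of vectors `c` with `f(·) c` in `L¹`
the map `c ↦ f(·) c` is bounded (`exists_lintegral_enorm_apply_le`).

For `R`, `ν_m ≤ ν` bounds `J` by the tail over `𝒯 ∖ 𝒯_n` of a convergent integral, the one for `X =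
Q(0)`. The drift for `ν_m` is the drift for `ν`, again a tail, minus the drift for `ν - ν_m`,
already treated. -/

/-! ### Mean and variance of the Poisson distribution -/

section PoissonMoments

lemma hasSum_poisson_mul_id (r : ℝ≥0) :
    HasSum (fun n : ℕ => Real.exp (-r) * r ^ n / n.factorial * n) r := by
  rw [← hasSum_nat_add_iff' 1]
  have h := (hasSum_one_poissonMeasure r).mul_left (r : ℝ)
  simp only [Finset.range_one, Finset.sum_singleton, Nat.cast_zero, mul_zero, sub_zero]
  rw [mul_one] at h
  refine h.congr_fun fun n => ?_
  rw [Nat.factorial_succ]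
  push_cast
  field_simp
  ring

/-- Dropping the vanishing term at `0` and shifting, `(n + 1)² r^(n+1) / (n+1)! = r (n + 1) r^n /
n!`, so the sum is `r` times the total mass plus the mean. -/
lemma hasSum_poisson_mul_sq (r : ℝ≥0) :
    HasSum (fun n : ℕ => Real.exp (-r) * r ^ n / n.factorial * (n : ℝ) ^ 2) (r + r ^ 2) := by
  rw [← hasSum_nat_add_iff' 1]
  have h := ((hasSum_one_poissonMeasure r).add (hasSum_poisson_mul_id r)).mul_left (r : ℝ)
  simp only [Finset.range_one, Finset.sum_singleton, Nat.cast_zero, sub_zero, ne_eq,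
    OfNat.ofNat_ne_zero, not_false_eq_true, zero_pow, mul_zero]
  have e : (r : ℝ) * (1 + r) = r + r ^ 2 := by ring
  rw [e] at h
  refine h.congr_fun fun n => ?_
  rw [Nat.factorial_succ]
  push_cast
  field_simp
  ring

lemma memLp_two_cast_poissonMeasure (r : ℝ≥0) :
    MemLp (fun n : ℕ => (n : ℝ)) 2 (poissonMeasure r) := by
  rw [memLp_two_iff_integrable_sq .of_discrete, integrable_poissonMeasure_iff]
  simpa using (hasSum_poisson_mul_sq r).summable

lemma integral_cast_poissonMeasure (r : ℝ≥0) : ∫ n : ℕ, (n : ℝ) ∂(poissonMeasure r) = r := by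
  rw [integral_poissonMeasure]
  simpa using (hasSum_poisson_mul_id r).tsum_eq

lemma integral_cast_sub_sq_poissonMeasure (r : ℝ≥0) :
    ∫ n : ℕ, ((n : ℝ) - r) ^ 2 ∂(poissonMeasure r) = r := by
  rw [integral_poissonMeasure]
  have h := ((hasSum_poisson_mul_sq r).sub ((hasSum_poisson_mul_id r).mul_left (2 * (r : ℝ)))).add
    ((hasSum_one_poissonMeasure r).mul_left ((r : ℝ) ^ 2))
  have e : (r : ℝ) + r ^ 2 - 2 * r * r + r ^ 2 * 1 = r := by ring
  rw [e] at h
  refine (tsum_congr fun n => ?_).trans h.tsum_eq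
  rw [smul_eq_mul]
  ring

end PoissonMoments

/-! ### Counts of a Poisson random measure -/

namespace IsPoissonRandomMeasure

variable {Ω X : Type*} [MeasurableSpace Ω] [MeasurableSpace X] {P : Measure Ω}
  {M : Ω → Measure X} {Λ : Measure X}

lemma measurable_measure (hM : IsPoissonRandomMeasure P M Λ) {B : Set X} (hB : MeasurableSet B) :
    Measurable fun ω => M ω B :=
  (Measure.measurable_coe hB).comp hM.measurable

lemma measurable_real (hM : IsPoissonRandomMeasure P M Λ) {B : Set X} (hB : MeasurableSet B) :
    Measurable fun ω => (M ω).real B :=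
  (hM.measurable_measure hB).ennreal_toReal

lemma map_real (hM : IsPoissonRandomMeasure P M Λ) {B : Set X} (hB : MeasurableSet B)
    (hΛ : Λ B < ∞) :
    P.map (fun ω => (M ω).real B) =
      (poissonMeasure (Λ B).toNNReal).map (fun k : ℕ => (k : ℝ)) := by
  have h := congrArg (Measure.map ENNReal.toReal) (hM.map_eq B hB hΛ)
  rw [Measure.map_map ENNReal.measurable_toReal (hM.measurable_measure hB),
    Measure.map_map ENNReal.measurable_toReal .of_discrete] at h
  exact h

lemma ae_lt_top (hM : IsPoissonRandomMeasure P M Λ) {B : Set X} (hB : MeasurableSet B)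
    (hΛ : Λ B < ∞) : ∀ᵐ ω ∂P, M ω B < ∞ := by
  have h : ∀ᵐ x ∂(P.map fun ω => M ω B), x < ∞ := by
    rw [hM.map_eq B hB hΛ, ae_map_iff .of_discrete measurableSet_Iio]
    exact .of_forall fun k => ENNReal.natCast_lt_top k
  exact (ae_map_iff (hM.measurable_measure hB).aemeasurable measurableSet_Iio).1 h

/-- This is `1 - exp (-r) ≤ r`. It controls large jumps without any moment assumption on them. -/
lemma measure_ne_zero_le (hM : IsPoissonRandomMeasure P M Λ) {B : Set X} (hB : MeasurableSet B) :
    P {ω | M ω B ≠ 0} ≤ Λ B := by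
  rcases lt_or_ge (Λ B) ∞ with hΛ | hΛ
  swap
  · exact le_top.trans hΛ
  set r := (Λ B).toNNReal
  have h1 : P {ω | M ω B ≠ 0} = poissonMeasure r {0}ᶜ := by
    have := congrArg (fun μ => μ {0}ᶜ) (hM.map_eq B hB hΛ)
    rw [Measure.map_apply (hM.measurable_measure hB) (measurableSet_singleton 0).compl,
      Measure.map_apply .of_discrete (measurableSet_singleton 0).compl] at this
    convert! this using 2
    ext k
    simp
  rw [h1, prob_compl_eq_one_sub (measurableSet_singleton 0), poissonMeasure_singleton,
    ← ENNReal.ofReal_one, ← ENNReal.ofReal_sub _ (by positivity), ← ENNReal.coe_toNNReal hΛ.ne,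
    ← ENNReal.ofReal_coe_nnreal]
  refine ENNReal.ofReal_le_ofReal ?_
  have := Real.add_one_le_exp (-(r : ℝ))
  simp
  linarith

lemma memLp_real (hM : IsPoissonRandomMeasure P M Λ) {B : Set X} (hB : MeasurableSet B)
    (hΛ : Λ B < ∞) : MemLp (fun ω => (M ω).real B) 2 P := by
  have h : MemLp (fun x : ℝ => x) 2 (P.map fun ω => (M ω).real B) := by
    rw [hM.map_real hB hΛ, memLp_map_measure_iff (by fun_prop) .of_discrete]
    exact memLp_two_cast_poissonMeasure _
  rwa [memLp_map_measure_iff (by fun_prop) (hM.measurable_real hB).aemeasurable] at h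

lemma integral_real (hM : IsPoissonRandomMeasure P M Λ) {B : Set X} (hB : MeasurableSet B)
    (hΛ : Λ B < ∞) : ∫ ω, (M ω).real B ∂P = Λ.real B := by
  have h : ∫ x : ℝ, x ∂(P.map fun ω => (M ω).real B) = Λ.real B := by
    rw [hM.map_real hB hΛ, integral_map .of_discrete (by fun_prop), integral_cast_poissonMeasure]
    rfl
  rwa [integral_map (hM.measurable_real hB).aemeasurable (by fun_prop)] at h

lemma integral_real_sub_sq (hM : IsPoissonRandomMeasure P M Λ) {B : Set X}
    (hB : MeasurableSet B) (hΛ : Λ B < ∞) :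
    ∫ ω, ((M ω).real B - Λ.real B) ^ 2 ∂P = Λ.real B := by
  have h : ∫ x : ℝ, (x - Λ.real B) ^ 2 ∂(P.map fun ω => (M ω).real B) = Λ.real B := by
    rw [hM.map_real hB hΛ, integral_map .of_discrete (by fun_prop)]
    exact integral_cast_sub_sq_poissonMeasure _
  rwa [integral_map (hM.measurable_real hB).aemeasurable (by fun_prop)] at h

lemma indepFun_real (hM : IsPoissonRandomMeasure P M Λ) {B C : Set X}
    (hB : MeasurableSet B) (hC : MeasurableSet C) (hBC : Disjoint B C) :
    IndepFun (fun ω => (M ω).real B) (fun ω => (M ω).real C) P := by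
  have h := hM.iIndepFun 2 ![B, C] (by simp [Fin.forall_fin_two, hB, hC])
    (by
      intro i j hij
      fin_cases i <;> fin_cases j <;> simp_all [disjoint_comm])
  have h2 := h.indepFun (show (0 : Fin 2) ≠ 1 by decide)
  exact h2.comp ENNReal.measurable_toReal ENNReal.measurable_toReal

lemma integral_real_sub_mul_real_sub [IsProbabilityMeasure P]
    (hM : IsPoissonRandomMeasure P M Λ) {B C : Set X}
    (hB : MeasurableSet B) (hC : MeasurableSet C) (hBC : Disjoint B C)
    (hΛB : Λ B < ∞) :
    ∫ ω, ((M ω).real B - Λ.real B) * ((M ω).real C - Λ.real C) ∂P = 0 := by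
  have h : IndepFun (fun ω => (M ω).real B - Λ.real B) (fun ω => (M ω).real C - Λ.real C) P :=
    (hM.indepFun_real hB hC hBC).comp (measurable_id.sub_const _) (measurable_id.sub_const _)
  rw [h.integral_fun_mul_eq_mul_integral
    ((hM.measurable_real hB).sub_const _).aestronglyMeasurable
    ((hM.measurable_real hC).sub_const _).aestronglyMeasurable,
    integral_sub ((hM.memLp_real hB hΛB).integrable one_le_two) (integrable_const _),
    hM.integral_real hB hΛB]
  simp

end IsPoissonRandomMeasure

/-! ### Second moments of compensated integrals over sets of finite intensity -/

lemma setIntegral_simpleFunc {X E : Type*} [MeasurableSpace X] [NormedAddCommGroup E]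
    [NormedSpace ℝ E] [CompleteSpace E] (μ : Measure X) (g : SimpleFunc X E) {C : Set X}
    (hC : μ C < ∞) :
    ∫ x in C, g x ∂μ = ∑ y ∈ g.range, μ.real (g ⁻¹' {y} ∩ C) • y := by
  have : IsFiniteMeasure (μ.restrict C) := ⟨by simpa using hC⟩
  rw [← SimpleFunc.integral_eq_integral _ (g.integrable_of_isFiniteMeasure),
    SimpleFunc.integral_eq]
  refine Finset.sum_congr rfl fun y _ => ?_
  rw [measureReal_restrict_apply (g.measurableSet_fiber y)]

namespace IsPoissonRandomMeasure

variable {Ω X E : Type*} [MeasurableSpace Ω] [MeasurableSpace X] {P : Measure Ω}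
  {M : Ω → Measure X} {Λ : Measure X}
  [NormedAddCommGroup E]

/-- The level sets of `g` are disjoint, so their centred counts are uncorrelated. Expanding the
square leaves the diagonal, where the variance of a count equals its intensity. -/
lemma lintegral_enorm_sq_simpleFunc [InnerProductSpace ℝ E] [CompleteSpace E]
    [IsProbabilityMeasure P]
    (hM : IsPoissonRandomMeasure P M Λ)
    {C : Set X} (hC : MeasurableSet C) (hΛ : Λ C < ∞) (g : SimpleFunc X E) :
    ∫⁻ ω, ‖(∫ x in C, g x ∂(M ω)) - ∫ x in C, g x ∂Λ‖ₑ ^ 2 ∂P = ∫⁻ x in C, ‖g x‖ₑ ^ 2 ∂Λ := by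
  set B : E → Set X := fun y => g ⁻¹' {y} ∩ C
  have hB : ∀ y, MeasurableSet (B y) := fun y => (g.measurableSet_fiber y).inter hC
  have hΛB : ∀ y, Λ (B y) < ∞ := fun y => (measure_mono inter_subset_right).trans_lt hΛ
  have hdisj : ∀ y z, y ≠ z → Disjoint (B y) (B z) := fun y z hyz =>
    (Disjoint.preimage g (disjoint_singleton.2 hyz)).mono inter_subset_left inter_subset_left
  set N : E → Ω → ℝ := fun y ω => (M ω).real (B y) - Λ.real (B y)
  have hN : ∀ y, MemLp (N y) 2 P := fun y => (hM.memLp_real (hB y) (hΛB y)).sub (memLp_const _)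
  have hae : ∀ᵐ ω ∂P, (∫ x in C, g x ∂(M ω)) - ∫ x in C, g x ∂Λ = ∑ y ∈ g.range, N y ω • y := by
    filter_upwards [hM.ae_lt_top hC hΛ] with ω hω
    rw [setIntegral_simpleFunc _ g hω, setIntegral_simpleFunc _ g hΛ, ← Finset.sum_sub_distrib]
    simp only [N, B, sub_smul]
  have hsq : ∀ ω, ‖∑ y ∈ g.range, N y ω • y‖ ^ 2 =
      ∑ y ∈ g.range, ∑ z ∈ g.range, N y ω * N z ω * inner ℝ y z := by
    intro ω
    rw [← real_inner_self_eq_norm_sq, sum_inner]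
    refine Finset.sum_congr rfl fun y _ => ?_
    rw [inner_sum]
    refine Finset.sum_congr rfl fun z _ => ?_
    rw [real_inner_smul_left, real_inner_smul_right, mul_assoc]
  have hint : ∀ y z, Integrable (fun ω => N y ω * N z ω * inner ℝ y z) P := fun y z =>
    ((hN y).integrable_mul (hN z)).mul_const _
  have hE : ∫ ω, ‖∑ y ∈ g.range, N y ω • y‖ ^ 2 ∂P =
      ∑ y ∈ g.range, Λ.real (B y) * ‖y‖ ^ 2 := by
    simp_rw [hsq]
    rw [integral_finsetSum _ fun y _ => integrable_finsetSum _ fun z _ => hint y z]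
    refine Finset.sum_congr rfl fun y hy => ?_
    rw [integral_finsetSum _ fun z _ => hint y z, Finset.sum_eq_single_of_mem y hy]
    · rw [integral_mul_const, real_inner_self_eq_norm_sq]
      congr 1
      rw [← hM.integral_real_sub_sq (hB y) (hΛB y)]
      simp only [N, sq]
    · intro z _ hz
      rw [integral_mul_const, hM.integral_real_sub_mul_real_sub (hB y) (hB z)
        (hdisj y z hz.symm) (hΛB y), zero_mul]
  have h1 : ∫⁻ ω, ‖(∫ x in C, g x ∂(M ω)) - ∫ x in C, g x ∂Λ‖ₑ ^ 2 ∂P =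
      ENNReal.ofReal (∫ ω, ‖∑ y ∈ g.range, N y ω • y‖ ^ 2 ∂P) := by
    rw [ofReal_integral_eq_lintegral_ofReal]
    · refine lintegral_congr_ae ?_
      filter_upwards [hae] with ω hω
      rw [hω, ENNReal.ofReal_pow (norm_nonneg _), ofReal_norm]
    · simp_rw [hsq]
      exact integrable_finsetSum _ fun y _ => integrable_finsetSum _ fun z _ => hint y z
    · exact .of_forall fun ω => by positivity
  have h2 : ∫⁻ x in C, ‖g x‖ₑ ^ 2 ∂Λ = ∑ y ∈ g.range, ‖y‖ₑ ^ 2 * Λ (B y) := by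
    have := SimpleFunc.map_lintegral (μ := Λ.restrict C) (fun y : E => ‖y‖ₑ ^ 2) g
    rw [← SimpleFunc.lintegral_eq_lintegral] at this
    simp only [SimpleFunc.coe_map, Function.comp_def] at this
    rw [this]
    refine Finset.sum_congr rfl fun y _ => ?_
    rw [Measure.restrict_apply (g.measurableSet_fiber y)]
  rw [h1, h2, hE, ENNReal.ofReal_sum_of_nonneg fun y _ => by positivity]
  refine Finset.sum_congr rfl fun y _ => ?_
  rw [ENNReal.ofReal_mul (by positivity), ENNReal.ofReal_pow (norm_nonneg _), ofReal_norm,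
    ofReal_measureReal (hΛB y).ne, mul_comm]

variable [MeasurableSpace E] [BorelSpace E] [SecondCountableTopology E]

/-- Integrability under `Λ` is not needed: almost surely `M` has finite mass on `C`, and `g` is
bounded almost everywhere for that mass, because the intensity of `{‖g‖ > K}` in `C` tends to `0` as
`K → ∞`. -/
lemma ae_integrableOn (hM : IsPoissonRandomMeasure P M Λ) {C : Set X} (hC : MeasurableSet C)
    (hΛ : Λ C < ∞) {g : X → E} (hg : Measurable g) : ∀ᵐ ω ∂P, IntegrableOn g C (M ω) := by
  let D : ℕ → Set X := fun K => C ∩ {x | (K : ℝ) < ‖g x‖}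
  have hD : ∀ K, MeasurableSet (D K) := fun K =>
    hC.inter (measurableSet_lt measurable_const hg.norm)
  have hlim : Tendsto (fun K => Λ (D K)) atTop (𝓝 0) := by
    have h := tendsto_measure_iInter_atTop (μ := Λ) (fun K => (hD K).nullMeasurableSet)
      (fun K L hKL x hx => ⟨hx.1, (Nat.cast_le (α := ℝ).2 hKL).trans_lt hx.2⟩)
      ⟨0, ((measure_mono inter_subset_left).trans_lt hΛ).ne⟩
    have he : ⋂ K, D K = ∅ := by
      refine eq_empty_of_forall_notMem fun x hx => ?_
      obtain ⟨K, hK⟩ := exists_nat_ge ‖g x‖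
      exact absurd ((mem_iInter.1 hx K).2) (not_lt.2 hK)
    rw [he, measure_empty] at h
    exact h
  have hex : ∀ᵐ ω ∂P, ∃ K, M ω (D K) = 0 := by
    rw [ae_iff]
    refine le_antisymm (ge_of_tendsto' hlim fun K => ?_) bot_le
    refine (measure_mono fun ω hω => ?_).trans (hM.measure_ne_zero_le (hD K))
    exact fun h => hω ⟨K, h⟩
  filter_upwards [hex, hM.ae_lt_top hC hΛ] with ω ⟨K, hK⟩ hfin
  have hb : ∀ᵐ x ∂(M ω).restrict C, ‖g x‖ ≤ K := by
    rw [ae_restrict_iff' hC, ae_iff]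
    convert! hK using 2
    ext x
    simp [D]
  have : IsFiniteMeasure ((M ω).restrict C) := ⟨by simpa using hfin⟩
  exact Integrable.of_bound hg.aestronglyMeasurable K hb

variable [InnerProductSpace ℝ E]

lemma ae_tendsto_setIntegral_approxOn (hM : IsPoissonRandomMeasure P M Λ) {C : Set X}
    (hC : MeasurableSet C) (hΛ : Λ C < ∞) {g : X → E} (hg : Measurable g) :
    ∀ᵐ ω ∂P, Tendsto (fun n => ∫ x in C, SimpleFunc.approxOn g hg univ 0 (mem_univ 0) n x ∂(M ω))
      atTop (𝓝 (∫ x in C, g x ∂(M ω))) := by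
  filter_upwards [hM.ae_integrableOn hC hΛ hg] with ω hω
  refine tendsto_integral_of_dominated_convergence (fun x => ‖g x‖ + ‖g x‖)
    (fun _ => (SimpleFunc.measurable _).aestronglyMeasurable) (hω.norm.add hω.norm)
    (fun n => .of_forall fun x => SimpleFunc.norm_approxOn_zero_le hg (mem_univ 0) x n)
    (.of_forall fun x => SimpleFunc.tendsto_approxOn hg (mem_univ 0) (by simp))

variable [CompleteSpace E]

lemma aemeasurable_setIntegral_simpleFunc (hM : IsPoissonRandomMeasure P M Λ) {C : Set X}
    (hC : MeasurableSet C) (hΛ : Λ C < ∞) (g : SimpleFunc X E) :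
    AEMeasurable (fun ω => ∫ x in C, g x ∂(M ω)) P := by
  have h : Measurable fun ω => ∑ y ∈ g.range, (M ω).real (g ⁻¹' {y} ∩ C) • y :=
    Finset.measurable_fun_sum _ fun y _ =>
      (hM.measurable_real ((g.measurableSet_fiber y).inter hC)).smul_const y
  refine h.aemeasurable.congr ?_
  filter_upwards [hM.ae_lt_top hC hΛ] with ω hω
  exact (setIntegral_simpleFunc _ g hω).symm

lemma aemeasurable_setIntegral (hM : IsPoissonRandomMeasure P M Λ) {C : Set X}
    (hC : MeasurableSet C) (hΛ : Λ C < ∞) {g : X → E} (hg : Measurable g) :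
    AEMeasurable (fun ω => ∫ x in C, g x ∂(M ω)) P :=
  aemeasurable_of_tendsto_metrizable_ae' (fun _ => hM.aemeasurable_setIntegral_simpleFunc hC hΛ _)
    (hM.ae_tendsto_setIntegral_approxOn hC hΛ hg)

/-- Fatou's lemma along simple approximations, for which the isometry is exact. The inequality is
all that is used later. -/
lemma lintegral_enorm_sq_le [IsProbabilityMeasure P] (hM : IsPoissonRandomMeasure P M Λ)
    {C : Set X} (hC : MeasurableSet C) (hΛ : Λ C < ∞) {g : X → E} (hg : Measurable g) :
    ∫⁻ ω, ‖(∫ x in C, g x ∂(M ω)) - ∫ x in C, g x ∂Λ‖ₑ ^ 2 ∂P ≤ ∫⁻ x in C, ‖g x‖ₑ ^ 2 ∂Λ := by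
  rcases eq_or_ne (∫⁻ x in C, ‖g x‖ₑ ^ 2 ∂Λ) ∞ with htop | htop
  · exact htop ▸ le_top
  have : IsFiniteMeasure (Λ.restrict C) := ⟨by simpa using hΛ⟩
  have hL2 : MemLp g 2 (Λ.restrict C) := by
    refine ⟨hg.aestronglyMeasurable, ?_⟩
    rw [eLpNorm_lt_top_iff_lintegral_rpow_enorm_lt_top (by simp) (by simp)]
    simpa using htop.lt_top
  have hint : Integrable g (Λ.restrict C) := hL2.integrable one_le_two
  let G := fun n => SimpleFunc.approxOn g hg univ 0 (mem_univ 0) n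
  have hGle : ∀ n x, ‖G n x‖ ≤ ‖g x‖ + ‖g x‖ := fun n x =>
    SimpleFunc.norm_approxOn_zero_le hg (mem_univ 0) x n
  have hGt : ∀ x, Tendsto (fun n => G n x) atTop (𝓝 (g x)) := fun x =>
    SimpleFunc.tendsto_approxOn hg (mem_univ 0) (by simp)
  have hΛt : Tendsto (fun n => ∫ x in C, G n x ∂Λ) atTop (𝓝 (∫ x in C, g x ∂Λ)) :=
    tendsto_integral_of_dominated_convergence (fun x => ‖g x‖ + ‖g x‖)
      (fun _ => (SimpleFunc.measurable _).aestronglyMeasurable) (hint.norm.add hint.norm)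
      (fun n => .of_forall (hGle n)) (.of_forall hGt)
  have hR : Tendsto (fun n => ∫⁻ x in C, ‖G n x‖ₑ ^ 2 ∂Λ) atTop
      (𝓝 (∫⁻ x in C, ‖g x‖ₑ ^ 2 ∂Λ)) := by
    -- The approximations satisfy `‖G n x‖ ≤ 2 ‖g x‖`, hence the factor `4`.
    refine tendsto_lintegral_of_dominated_convergence (fun x => 4 * ‖g x‖ₑ ^ 2)
      (fun n => by
        have := (G n).measurable
        fun_prop) (fun n => .of_forall fun x => ?_) ?_ (.of_forall fun x => ?_)
    · have h : ‖G n x‖ₑ ≤ 2 * ‖g x‖ₑ := by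
        rw [two_mul, ← ofReal_norm, ← ofReal_norm,
          ← ENNReal.ofReal_add (norm_nonneg _) (norm_nonneg _)]
        exact ENNReal.ofReal_le_ofReal (hGle n x)
      calc ‖G n x‖ₑ ^ 2 ≤ (2 * ‖g x‖ₑ) ^ 2 := by gcongr
        _ = 4 * ‖g x‖ₑ ^ 2 := by rw [mul_pow]; norm_num
    · rw [lintegral_const_mul' _ _ (by simp)]
      exact ENNReal.mul_ne_top (by simp) htop
    · exact ((ENNReal.continuous_pow 2).tendsto _).comp ((hGt x).enorm)
  calc ∫⁻ ω, ‖(∫ x in C, g x ∂(M ω)) - ∫ x in C, g x ∂Λ‖ₑ ^ 2 ∂P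
      = ∫⁻ ω, liminf (fun n => ‖(∫ x in C, G n x ∂(M ω)) - ∫ x in C, G n x ∂Λ‖ₑ ^ 2) atTop ∂P := by
        refine lintegral_congr_ae ?_
        filter_upwards [hM.ae_tendsto_setIntegral_approxOn hC hΛ hg] with ω hω
        exact ((((ENNReal.continuous_pow 2).tendsto _).comp (hω.sub hΛt).enorm).liminf_eq).symm
    _ ≤ liminf (fun n => ∫⁻ ω, ‖(∫ x in C, G n x ∂(M ω)) - ∫ x in C, G n x ∂Λ‖ₑ ^ 2 ∂P) atTop :=
        lintegral_liminf_le' fun n =>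
          ((hM.aemeasurable_setIntegral_simpleFunc hC hΛ (G n)).sub_const _).enorm.pow_const 2
    _ = liminf (fun n => ∫⁻ x in C, ‖G n x‖ₑ ^ 2 ∂Λ) atTop := by
        simp_rw [hM.lintegral_enorm_sq_simpleFunc hC hΛ]
    _ = ∫⁻ x in C, ‖g x‖ₑ ^ 2 ∂Λ := hR.liminf_eq

end IsPoissonRandomMeasure

lemma exists_tendstoInMeasure_of_eLpNorm_two_cauchy {Ω E ι : Type*} [MeasurableSpace Ω]
    {P : Measure Ω} [NormedAddCommGroup E] [CompleteSpace E] [MeasurableSpace E] [BorelSpace E]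
    {l : Filter ι} [l.NeBot] (Z : ι → Ω → E) (hZ : ∀ᶠ i in l, MemLp (Z i) 2 P)
    (hC : ∀ e : ℝ≥0∞, 0 < e → ∃ s ∈ l, ∀ i ∈ s, ∀ j ∈ s, eLpNorm (Z i - Z j) 2 P < e) :
    ∃ Y : Ω → E, AEMeasurable Y P ∧ TendstoInMeasure P Z l Y := by
  classical
  -- The default `0` is harmless, since `Z i` is in `L²` eventually along `l`.
  let F : ι → Lp E 2 P := fun i => if h : MemLp (Z i) 2 P then h.toLp else 0
  have hF : ∀ i (h : MemLp (Z i) 2 P), F i = h.toLp := fun i h => dif_pos h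
  have hcau : Cauchy (map F l) := by
    rw [EMetric.cauchy_iff]
    refine ⟨(map_neBot).ne, fun e he => ?_⟩
    obtain ⟨s, hs, hse⟩ := hC e he
    refine ⟨F '' (s ∩ {i | MemLp (Z i) 2 P}), image_mem_map (inter_mem hs hZ), ?_⟩
    rintro _ ⟨i, ⟨his, hi⟩, rfl⟩ _ ⟨j, ⟨hjs, hj⟩, rfl⟩
    rw [hF i hi, hF j hj, Lp.edist_toLp_toLp]
    exact hse i his j hjs
  obtain ⟨Y, hY⟩ := CompleteSpace.complete hcau
  refine ⟨Y, (Lp.aestronglyMeasurable Y).aemeasurable,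
    (tendstoInMeasure_of_tendsto_Lp (show Tendsto F l (𝓝 Y) from hY)).congr' ?_ .rfl⟩
  filter_upwards [hZ] with i hi
  rw [hF i hi]
  exact hi.coeFn_toLp

/-! ### Jumps sorted by size, and their intensities -/

lemma jumps_Ioc_union {X E : Type*} [NormedAddCommGroup E] {D : Set X} {g : X → E}
    {ε δ η : ℝ} (h1 : ε ≤ δ) (h2 : δ ≤ η) :
    {p | p ∈ D ∧ ε < ‖g p‖ ∧ ‖g p‖ ≤ η} =
      {p | p ∈ D ∧ ε < ‖g p‖ ∧ ‖g p‖ ≤ δ} ∪ {p | p ∈ D ∧ δ < ‖g p‖ ∧ ‖g p‖ ≤ η} := by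
  ext p
  simp only [mem_ofPred_eq, mem_union]
  constructor
  · rintro ⟨hp, ha, hb⟩
    rcases le_or_gt ‖g p‖ δ with h | h
    · exact .inl ⟨hp, ha, h⟩
    · exact .inr ⟨hp, h, hb⟩
  · rintro (⟨hp, ha, hb⟩ | ⟨hp, ha, hb⟩)
    · exact ⟨hp, ha, hb.trans h2⟩
    · exact ⟨hp, h1.trans_lt ha, hb⟩

lemma jumps_gt_eq_union {X E : Type*} [NormedAddCommGroup E] {D : Set X} {g : X → E}
    {ε η : ℝ} (h : ε ≤ η) :
    {p | p ∈ D ∧ ε < ‖g p‖} =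
      {p | p ∈ D ∧ ε < ‖g p‖ ∧ ‖g p‖ ≤ η} ∪ {p | p ∈ D ∧ η < ‖g p‖} := by
  ext p
  simp only [mem_ofPred_eq, mem_union]
  constructor
  · rintro ⟨hp, ha⟩
    rcases le_or_gt ‖g p‖ η with h | h
    · exact .inl ⟨hp, ha, h⟩
    · exact .inr ⟨hp, h⟩
  · rintro (⟨hp, ha, hb⟩ | ⟨hp, ha⟩)
    · exact ⟨hp, ha⟩
    · exact ⟨hp, h.trans_lt ha⟩

section SmallJumps

variable {X E : Type*} [MeasurableSpace X] {Λ : Measure X} [NormedAddCommGroup E]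
  [MeasurableSpace E] [BorelSpace E] {D : Set X} {g : X → E}

lemma measurableSet_jumps_gt (hD : MeasurableSet D) (hg : Measurable g) (ε : ℝ) :
    MeasurableSet {p | p ∈ D ∧ ε < ‖g p‖} :=
  hD.inter (measurableSet_lt measurable_const hg.norm)

lemma measurableSet_jumps_Ioc (hD : MeasurableSet D) (hg : Measurable g) (ε δ : ℝ) :
    MeasurableSet {p | p ∈ D ∧ ε < ‖g p‖ ∧ ‖g p‖ ≤ δ} :=
  hD.inter ((measurableSet_lt measurable_const hg.norm).inter
    (measurableSet_le hg.norm measurable_const))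

lemma measure_jumps_gt_one_le (hD : MeasurableSet D) (hg : Measurable g) :
    Λ {p | p ∈ D ∧ 1 < ‖g p‖} ≤ ∫⁻ p in D, min 1 (‖g p‖ₑ ^ 2) ∂Λ := by
  rw [← setLIntegral_one]
  calc ∫⁻ _ in {p | p ∈ D ∧ 1 < ‖g p‖}, 1 ∂Λ
      ≤ ∫⁻ p in {p | p ∈ D ∧ 1 < ‖g p‖}, min 1 (‖g p‖ₑ ^ 2) ∂Λ := by
        refine setLIntegral_mono' (measurableSet_jumps_gt hD hg 1) fun p hp => le_min le_rfl ?_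
        refine one_le_pow₀ ?_
        rw [← ofReal_norm, ENNReal.one_le_ofReal]
        exact hp.2.le
    _ ≤ _ := lintegral_mono_set fun p hp => hp.1

lemma measure_jumps_gt_lt_top (hD : MeasurableSet D) (hg : Measurable g)
    (hJ : ∫⁻ p in D, min 1 (‖g p‖ₑ ^ 2) ∂Λ < ∞) {ε : ℝ} (hε : 0 < ε) :
    Λ {p | p ∈ D ∧ ε < ‖g p‖} < ∞ := by
  -- Markov's inequality at the least value that `1 ∧ ‖g‖²` can approach on `{‖g‖ > ε}`.
  set c : ℝ≥0∞ := min 1 (ENNReal.ofReal ε ^ 2)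
  have hc : c ≠ 0 := by
    have : 0 < c := lt_min one_pos (ENNReal.pow_pos (ENNReal.ofReal_pos.2 hε) 2)
    exact this.ne'
  have h := meas_ge_le_lintegral_div (μ := Λ.restrict D) (f := fun p => min 1 (‖g p‖ₑ ^ 2))
    (by fun_prop) hc ((min_le_left _ _).trans_lt ENNReal.one_lt_top).ne
  refine (le_trans ?_ h).trans_lt (ENNReal.div_lt_top hJ.ne hc)
  rw [Measure.restrict_apply' hD]
  refine measure_mono fun p hp => ⟨(?_ : c ≤ min 1 (‖g p‖ₑ ^ 2)), hp.1⟩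
  refine min_le_min le_rfl ?_
  have : ENNReal.ofReal ε ≤ ‖g p‖ₑ := by
    rw [← ofReal_norm]
    exact ENNReal.ofReal_le_ofReal hp.2.le
  gcongr

lemma measure_jumps_Ioc_lt_top (hD : MeasurableSet D) (hg : Measurable g)
    (hJ : ∫⁻ p in D, min 1 (‖g p‖ₑ ^ 2) ∂Λ < ∞) {ε : ℝ} (hε : 0 < ε) (δ : ℝ) :
    Λ {p | p ∈ D ∧ ε < ‖g p‖ ∧ ‖g p‖ ≤ δ} < ∞ :=
  lt_of_le_of_lt (measure_mono (t := {p | p ∈ D ∧ ε < ‖g p‖}) fun _ hp => ⟨hp.1, hp.2.1⟩)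
    (measure_jumps_gt_lt_top hD hg hJ hε)

lemma lintegral_jumps_Ioc_le (hD : MeasurableSet D) (hg : Measurable g) (ε : ℝ) :
    ∫⁻ p in {p | p ∈ D ∧ ε < ‖g p‖ ∧ ‖g p‖ ≤ 1}, ‖g p‖ₑ ^ 2 ∂Λ ≤
      ∫⁻ p in D, min 1 (‖g p‖ₑ ^ 2) ∂Λ := by
  calc ∫⁻ p in {p | p ∈ D ∧ ε < ‖g p‖ ∧ ‖g p‖ ≤ 1}, ‖g p‖ₑ ^ 2 ∂Λ
      ≤ ∫⁻ p in {p | p ∈ D ∧ ε < ‖g p‖ ∧ ‖g p‖ ≤ 1}, min 1 (‖g p‖ₑ ^ 2) ∂Λ := by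
        refine setLIntegral_mono' (measurableSet_jumps_Ioc hD hg ε 1) fun p hp => le_min ?_ le_rfl
        refine pow_le_one₀ bot_le ?_
        rw [← ofReal_norm]
        exact ENNReal.ofReal_le_one.2 hp.2.2
    _ ≤ _ := lintegral_mono_set fun p hp => hp.1

/-- Dominated convergence with bound `1 ∧ ‖g‖²`: each point with `g p ≠ 0` leaves the set once `δ <
‖g p‖`. This tail controls the `L²` Cauchy property of the truncated integrals. -/
lemma tendsto_lintegral_jumps_Ioc_zero (hD : MeasurableSet D) (hg : Measurable g)
    (hJ : ∫⁻ p in D, min 1 (‖g p‖ₑ ^ 2) ∂Λ < ∞) :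
    Tendsto (fun δ : ℝ => ∫⁻ p in {p | p ∈ D ∧ 0 < ‖g p‖ ∧ ‖g p‖ ≤ δ}, ‖g p‖ₑ ^ 2 ∂Λ)
      (𝓝[>] 0) (𝓝 0) := by
  have h := tendsto_lintegral_filter_of_dominated_convergence (μ := Λ) (l := 𝓝[>] (0 : ℝ))
    (F := fun δ => {p | p ∈ D ∧ 0 < ‖g p‖ ∧ ‖g p‖ ≤ δ}.indicator fun p => ‖g p‖ₑ ^ 2)
    (f := fun _ => 0) (D.indicator fun p => min 1 (‖g p‖ₑ ^ 2))
    (.of_forall fun δ => (hg.enorm.pow_const 2).indicator (measurableSet_jumps_Ioc hD hg 0 δ))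
    ?_ (by rw [lintegral_indicator hD]; exact hJ.ne) ?_
  · rw [lintegral_zero] at h
    refine h.congr fun δ => ?_
    rw [lintegral_indicator (measurableSet_jumps_Ioc hD hg 0 δ)]
  · have h1 : ∀ᶠ δ : ℝ in 𝓝[>] 0, δ ≤ 1 :=
      mem_nhdsWithin_of_mem_nhds (Iic_mem_nhds one_pos)
    filter_upwards [h1] with δ hδ
    refine .of_forall fun p => indicator_apply_le fun hp => ?_
    rw [indicator_of_mem hp.1]
    refine le_min (pow_le_one₀ bot_le ?_) le_rfl
    rw [← ofReal_norm]
    exact ENNReal.ofReal_le_one.2 (hp.2.2.trans hδ)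
  · refine .of_forall fun p => tendsto_const_nhds.congr' ?_
    by_cases hp : 0 < ‖g p‖
    · filter_upwards [mem_nhdsWithin_of_mem_nhds (Iio_mem_nhds hp)] with δ hδ
      exact (indicator_of_notMem (fun h => (not_lt.2 h.2.2) hδ) _).symm
    · exact .of_forall fun δ => (indicator_of_notMem (fun h => hp h.2.1) _).symm

end SmallJumps

/-! ### Removing the truncation of the small jumps -/

namespace IsPoissonRandomMeasure

variable {Ω X E : Type*} [MeasurableSpace Ω] [MeasurableSpace X] {P : Measure Ω}
  {M : Ω → Measure X} {Λ : Measure X}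
  [NormedAddCommGroup E] [MeasurableSpace E] [BorelSpace E] [SecondCountableTopology E]
  [InnerProductSpace ℝ E] {D : Set X} {g : X → E}

lemma compensated_add (hM : IsPoissonRandomMeasure P M Λ) (hD : MeasurableSet D)
    (hg : Measurable g) (hJ : ∫⁻ p in D, min 1 (‖g p‖ₑ ^ 2) ∂Λ < ∞) {ε δ η : ℝ} (hε : 0 < ε)
    (h1 : ε ≤ δ) (h2 : δ ≤ η) :
    ∀ᵐ ω ∂P, (∫ p in {p | p ∈ D ∧ ε < ‖g p‖ ∧ ‖g p‖ ≤ η}, g p ∂(M ω))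
        - ∫ p in {p | p ∈ D ∧ ε < ‖g p‖ ∧ ‖g p‖ ≤ η}, g p ∂Λ =
      ((∫ p in {p | p ∈ D ∧ ε < ‖g p‖ ∧ ‖g p‖ ≤ δ}, g p ∂(M ω))
        - ∫ p in {p | p ∈ D ∧ ε < ‖g p‖ ∧ ‖g p‖ ≤ δ}, g p ∂Λ) +
      ((∫ p in {p | p ∈ D ∧ δ < ‖g p‖ ∧ ‖g p‖ ≤ η}, g p ∂(M ω))
        - ∫ p in {p | p ∈ D ∧ δ < ‖g p‖ ∧ ‖g p‖ ≤ η}, g p ∂Λ) := by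
  have hfin := measure_jumps_gt_lt_top hD hg hJ hε
  have hsub1 : {p | p ∈ D ∧ ε < ‖g p‖ ∧ ‖g p‖ ≤ δ} ⊆ {p | p ∈ D ∧ ε < ‖g p‖} :=
    fun p hp => ⟨hp.1, hp.2.1⟩
  have hsub2 : {p | p ∈ D ∧ δ < ‖g p‖ ∧ ‖g p‖ ≤ η} ⊆ {p | p ∈ D ∧ ε < ‖g p‖} :=
    fun p hp => ⟨hp.1, h1.trans_lt hp.2.1⟩
  have hdisj : Disjoint {p | p ∈ D ∧ ε < ‖g p‖ ∧ ‖g p‖ ≤ δ} {p | p ∈ D ∧ δ < ‖g p‖ ∧ ‖g p‖ ≤ η} :=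
    Set.disjoint_left.2 fun p hp hq => (not_lt.2 hp.2.2) hq.2.1
  have hint : ∀ a b : ℝ, {p | p ∈ D ∧ a < ‖g p‖ ∧ ‖g p‖ ≤ b} ⊆ {p | p ∈ D ∧ ε < ‖g p‖} →
      IntegrableOn g {p | p ∈ D ∧ a < ‖g p‖ ∧ ‖g p‖ ≤ b} Λ := by
    intro a b hab
    have : IsFiniteMeasure (Λ.restrict {p | p ∈ D ∧ a < ‖g p‖ ∧ ‖g p‖ ≤ b}) :=
      ⟨by simpa using (measure_mono hab).trans_lt hfin⟩
    refine Integrable.of_bound hg.aestronglyMeasurable b ?_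
    exact ae_restrict_of_forall_mem (measurableSet_jumps_Ioc hD hg a b) fun p hp => hp.2.2
  filter_upwards [hM.ae_integrableOn (measurableSet_jumps_gt hD hg ε) hfin hg] with ω hω
  rw [jumps_Ioc_union h1 h2, setIntegral_union hdisj (measurableSet_jumps_Ioc hD hg δ η)
      (hω.mono_set hsub1) (hω.mono_set hsub2),
    setIntegral_union hdisj (measurableSet_jumps_Ioc hD hg δ η)
      (hint ε δ hsub1) (hint δ η hsub2)]
  abel

lemma truncated_eq_compensated_add (hM : IsPoissonRandomMeasure P M Λ) (hD : MeasurableSet D)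
    (hg : Measurable g) (hJ : ∫⁻ p in D, min 1 (‖g p‖ₑ ^ 2) ∂Λ < ∞) {ε : ℝ} (hε : 0 < ε)
    (h1 : ε ≤ 1) :
    ∀ᵐ ω ∂P, (∫ p in {p | p ∈ D ∧ ε < ‖g p‖}, g p ∂(M ω))
        - ∫ p in {p | p ∈ D ∧ ε < ‖g p‖ ∧ ‖g p‖ ≤ 1}, g p ∂Λ =
      ((∫ p in {p | p ∈ D ∧ ε < ‖g p‖ ∧ ‖g p‖ ≤ 1}, g p ∂(M ω))
        - ∫ p in {p | p ∈ D ∧ ε < ‖g p‖ ∧ ‖g p‖ ≤ 1}, g p ∂Λ) +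
      ∫ p in {p | p ∈ D ∧ 1 < ‖g p‖}, g p ∂(M ω) := by
  have hdisj : Disjoint {p | p ∈ D ∧ ε < ‖g p‖ ∧ ‖g p‖ ≤ 1} {p | p ∈ D ∧ 1 < ‖g p‖} :=
    Set.disjoint_left.2 fun p hp hq => (not_lt.2 hp.2.2) hq.2
  filter_upwards [hM.ae_integrableOn (measurableSet_jumps_gt hD hg ε)
    (measure_jumps_gt_lt_top hD hg hJ hε) hg] with ω hω
  rw [jumps_gt_eq_union h1, setIntegral_union hdisj (measurableSet_jumps_gt hD hg 1)
      (hω.mono_set fun p hp => ⟨hp.1, hp.2.1⟩) (hω.mono_set fun p hp => ⟨hp.1, h1.trans_lt hp.2⟩)]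
  abel

variable [CompleteSpace E]

lemma aemeasurable_compensated (hM : IsPoissonRandomMeasure P M Λ)
    (hD : MeasurableSet D) (hg : Measurable g)
    (hJ : ∫⁻ p in D, min 1 (‖g p‖ₑ ^ 2) ∂Λ < ∞) {ε : ℝ} (hε : 0 < ε) (δ : ℝ) :
    AEMeasurable (fun ω => (∫ p in {p | p ∈ D ∧ ε < ‖g p‖ ∧ ‖g p‖ ≤ δ}, g p ∂(M ω))
        - ∫ p in {p | p ∈ D ∧ ε < ‖g p‖ ∧ ‖g p‖ ≤ δ}, g p ∂Λ) P :=
  (hM.aemeasurable_setIntegral (measurableSet_jumps_Ioc hD hg ε δ)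
    (measure_jumps_Ioc_lt_top hD hg hJ hε δ)
    hg).sub_const _

variable [IsProbabilityMeasure P]

lemma lintegral_enorm_sq_compensated_le (hM : IsPoissonRandomMeasure P M Λ)
    (hD : MeasurableSet D) (hg : Measurable g)
    (hJ : ∫⁻ p in D, min 1 (‖g p‖ₑ ^ 2) ∂Λ < ∞) {ε : ℝ} (hε : 0 < ε) (δ : ℝ) :
    ∫⁻ ω, ‖(∫ p in {p | p ∈ D ∧ ε < ‖g p‖ ∧ ‖g p‖ ≤ δ}, g p ∂(M ω))
        - ∫ p in {p | p ∈ D ∧ ε < ‖g p‖ ∧ ‖g p‖ ≤ δ}, g p ∂Λ‖ₑ ^ 2 ∂P ≤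
      ∫⁻ p in {p | p ∈ D ∧ ε < ‖g p‖ ∧ ‖g p‖ ≤ δ}, ‖g p‖ₑ ^ 2 ∂Λ :=
  hM.lintegral_enorm_sq_le (measurableSet_jumps_Ioc hD hg ε δ)
    (measure_jumps_Ioc_lt_top hD hg hJ hε δ) hg

/-- The compensated integrals of a function converge in probability when the truncation of the
small values of the function is removed. -/
lemma exists_tendstoInMeasure_truncated (hM : IsPoissonRandomMeasure P M Λ)
    (hD : MeasurableSet D) (hg : Measurable g)
    (hJ : ∫⁻ p in D, min 1 (‖g p‖ₑ ^ 2) ∂Λ < ∞) :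
    ∃ Y : Ω → E, AEMeasurable Y P ∧
      TendstoInMeasure P (fun (ε : ℝ) ω => (∫ p in {p | p ∈ D ∧ ε < ‖g p‖}, g p ∂(M ω))
        - ∫ p in {p | p ∈ D ∧ ε < ‖g p‖ ∧ ‖g p‖ ≤ 1}, g p ∂Λ) (𝓝[>] 0) Y := by
  let Z : ℝ → Ω → E := fun ε ω => (∫ p in {p | p ∈ D ∧ ε < ‖g p‖ ∧ ‖g p‖ ≤ 1}, g p ∂(M ω))
        - ∫ p in {p | p ∈ D ∧ ε < ‖g p‖ ∧ ‖g p‖ ≤ 1}, g p ∂Λ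
  have hIoc : Ioc (0 : ℝ) 1 ∈ 𝓝[>] (0 : ℝ) := Ioc_mem_nhdsGT one_pos
  have hsq : ∀ W : Ω → E, eLpNorm W 2 P = (∫⁻ ω, ‖W ω‖ₑ ^ 2 ∂P) ^ (1 / 2 : ℝ) := fun W => by
    rw [eLpNorm_eq_lintegral_rpow_enorm_toReal (by simp) (by simp)]
    simp
  have hmem : ∀ᶠ ε in 𝓝[>] (0 : ℝ), MemLp (Z ε) 2 P := by
    filter_upwards [hIoc] with ε hε
    refine ⟨(hM.aemeasurable_compensated hD hg hJ hε.1 1).aestronglyMeasurable, ?_⟩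
    rw [hsq]
    refine ENNReal.rpow_lt_top_of_nonneg (by norm_num) ?_
    exact ((hM.lintegral_enorm_sq_compensated_le hD hg hJ hε.1 1).trans_lt
      ((lintegral_jumps_Ioc_le hD hg ε).trans_lt hJ)).ne
  have hcau : ∀ e : ℝ≥0∞, 0 < e →
      ∃ s ∈ 𝓝[>] (0 : ℝ), ∀ i ∈ s, ∀ j ∈ s, eLpNorm (Z i - Z j) 2 P < e := by
    intro e he
    have hlim := (tendsto_lintegral_jumps_Ioc_zero hD hg hJ).ennrpow_const (1 / 2 : ℝ)
    rw [ENNReal.zero_rpow_of_pos (by norm_num)] at hlim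
    refine ⟨_, inter_mem hIoc (hlim.eventually (Iio_mem_nhds he)), ?_⟩
    -- For `i ≤ j`, the difference is the compensated integral over jumps of size in `(i, j]`.
    have key : ∀ i j : ℝ, i ∈ Ioc (0 : ℝ) 1 → j ∈ Ioc (0 : ℝ) 1 → i ≤ j →
        eLpNorm (Z i - Z j) 2 P ≤
          (∫⁻ p in {p | p ∈ D ∧ 0 < ‖g p‖ ∧ ‖g p‖ ≤ j}, ‖g p‖ₑ ^ 2 ∂Λ) ^ (1 / 2 : ℝ) := by
      intro i j hi hj hij
      rw [hsq]
      refine ENNReal.rpow_le_rpow ?_ (by norm_num)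
      calc ∫⁻ ω, ‖(Z i - Z j) ω‖ₑ ^ 2 ∂P
          = ∫⁻ ω, ‖(∫ p in {p | p ∈ D ∧ i < ‖g p‖ ∧ ‖g p‖ ≤ j}, g p ∂(M ω))
              - ∫ p in {p | p ∈ D ∧ i < ‖g p‖ ∧ ‖g p‖ ≤ j}, g p ∂Λ‖ₑ ^ 2 ∂P := by
            refine lintegral_congr_ae ?_
            filter_upwards [hM.compensated_add hD hg hJ hi.1 hij hj.2] with ω hω
            simp only [Pi.sub_apply, Z]
            rw [hω, add_sub_cancel_right]
        _ ≤ ∫⁻ p in {p | p ∈ D ∧ i < ‖g p‖ ∧ ‖g p‖ ≤ j}, ‖g p‖ₑ ^ 2 ∂Λ :=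
            hM.lintegral_enorm_sq_compensated_le hD hg hJ hi.1 j
        _ ≤ ∫⁻ p in {p | p ∈ D ∧ 0 < ‖g p‖ ∧ ‖g p‖ ≤ j}, ‖g p‖ₑ ^ 2 ∂Λ :=
            lintegral_mono_set fun p hp => ⟨hp.1, hi.1.trans hp.2.1, hp.2.2⟩
    rintro i ⟨hi, hie⟩ j ⟨hj, hje⟩
    rcases le_total i j with hij | hij
    · exact (key i j hi hj hij).trans_lt hje
    · rw [eLpNorm_sub_comm]
      exact (key j i hj hi hij).trans_lt hie
  obtain ⟨Y, hYm, hY⟩ := exists_tendstoInMeasure_of_eLpNorm_two_cauchy Z hmem hcau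
  -- The jumps larger than `1` need not be square integrable, but their sum does not depend on `ε`,
  -- so it is added after the `L²` limit.
  refine ⟨fun ω => Y ω + ∫ p in {p | p ∈ D ∧ 1 < ‖g p‖}, g p ∂(M ω),
    hYm.add (hM.aemeasurable_setIntegral (measurableSet_jumps_gt hD hg 1)
      (measure_jumps_gt_lt_top hD hg hJ one_pos) hg), ?_⟩
  have hY' : TendstoInMeasure P
      (fun ε ω => Z ε ω + ∫ p in {p | p ∈ D ∧ 1 < ‖g p‖}, g p ∂(M ω)) (𝓝[>] 0)
      (fun ω => Y ω + ∫ p in {p | p ∈ D ∧ 1 < ‖g p‖}, g p ∂(M ω)) := by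
    simpa only [TendstoInMeasure, edist_add_right] using hY
  refine hY'.congr' ?_ .rfl
  filter_upwards [hIoc] with ε hε
  filter_upwards [hM.truncated_eq_compensated_add hD hg hJ hε.1 hε.2] with ω hω
  exact hω.symm

/-- Either some jump exceeds `1`, or the truncated integral is its compensated part and Chebyshev's
inequality applies. The bound does not depend on `ε`. -/
lemma measure_truncated_ge_le (hM : IsPoissonRandomMeasure P M Λ)
    (hD : MeasurableSet D) (hg : Measurable g)
    (hJ : ∫⁻ p in D, min 1 (‖g p‖ₑ ^ 2) ∂Λ < ∞) {ε : ℝ} (hε : 0 < ε) (h1 : ε ≤ 1)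
    {η : ℝ≥0∞} (hη : η ≠ 0) (hη' : η ≠ ∞) :
    P {ω | η ≤ ‖(∫ p in {p | p ∈ D ∧ ε < ‖g p‖}, g p ∂(M ω))
        - ∫ p in {p | p ∈ D ∧ ε < ‖g p‖ ∧ ‖g p‖ ≤ 1}, g p ∂Λ‖ₑ} ≤
      (∫⁻ p in D, min 1 (‖g p‖ₑ ^ 2) ∂Λ) + (∫⁻ p in D, min 1 (‖g p‖ₑ ^ 2) ∂Λ) / η ^ 2 := by
  set Z : Ω → E := fun ω => (∫ p in {p | p ∈ D ∧ ε < ‖g p‖ ∧ ‖g p‖ ≤ 1}, g p ∂(M ω))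
        - ∫ p in {p | p ∈ D ∧ ε < ‖g p‖ ∧ ‖g p‖ ≤ 1}, g p ∂Λ with hZ
  calc _ ≤ P ({ω | M ω {p | p ∈ D ∧ 1 < ‖g p‖} ≠ 0} ∪ {ω | η ^ 2 ≤ ‖Z ω‖ₑ ^ 2}) := by
        refine measure_mono_ae ?_
        filter_upwards [hM.truncated_eq_compensated_add hD hg hJ hε h1] with ω hω hle
        by_cases h0 : M ω {p | p ∈ D ∧ 1 < ‖g p‖} = 0
        · right
          change η ≤ _ at hle
          rw [hω, setIntegral_measure_zero _ h0, add_zero] at hle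
          exact pow_le_pow_left₀ bot_le hle 2
        · exact .inl h0
    _ ≤ P {ω | M ω {p | p ∈ D ∧ 1 < ‖g p‖} ≠ 0} + P {ω | η ^ 2 ≤ ‖Z ω‖ₑ ^ 2} :=
        measure_union_le _ _
    _ ≤ _ := by
        gcongr
        · exact (hM.measure_ne_zero_le (measurableSet_jumps_gt hD hg 1)).trans
            (measure_jumps_gt_one_le hD hg)
        · refine (meas_ge_le_lintegral_div
            ((hM.aemeasurable_compensated hD hg hJ hε 1).enorm.pow_const 2)
            (pow_ne_zero 2 hη) (ENNReal.pow_ne_top hη')).trans ?_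
          gcongr
          exact (hM.lintegral_enorm_sq_compensated_le hD hg hJ hε 1).trans
            (lintegral_jumps_Ioc_le hD hg ε)

end IsPoissonRandomMeasure

/-! ### The stochastic integral over a time set -/

section PoissonIntegral

lemma measurable_eval_kernel {E : Type*} [NormedAddCommGroup E] [NormedSpace ℝ E]
    [SecondCountableTopology E] [SecondCountableTopology (E →L[ℝ] E)] [MeasurableSpace E]
    [BorelSpace E] {f : ℝ → E →L[ℝ] E} (hf : Measurable f) :
    Measurable fun p : E × ℝ => f p.2 p.1 :=
  (isBoundedBilinearMap_apply (𝕜 := ℝ) (E := E) (F := E)).continuous.measurable.comp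
    ((hf.comp measurable_snd).prodMk measurable_fst)

lemma setLIntegral_prod_time {E : Type*} [MeasurableSpace E] {ν : Measure E} [SFinite ν] {S T : Set ℝ} (hS : MeasurableSet S)
    (hST : S ⊆ T) {F : E × ℝ → ℝ≥0∞} (hF : Measurable F) :
    ∫⁻ p in Prod.snd ⁻¹' S, F p ∂(ν.prod (volume.restrict T)) =
      ∫⁻ s in S, ∫⁻ z, F (z, s) ∂ν := by
  have h : (Prod.snd ⁻¹' S : Set (E × ℝ)) = univ ×ˢ S := by ext; simp
  rw [h, ← Measure.prod_restrict, Measure.restrict_univ, Measure.restrict_restrict hS,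
    inter_eq_left.2 hST, lintegral_prod_symm _ hF.aemeasurable]

/-- Reconciles the random measure, whose intensity lives over `T`, with the compensator in
`truncatedPoissonIntegral`, which is written with all of `ℝ` as time axis. -/
lemma prod_time_restrict {E : Type*} [MeasurableSpace E] {ν : Measure E} [SFinite ν] {S T : Set ℝ} (hST : S ⊆ T)
    {C : Set (E × ℝ)} (hC : MeasurableSet C) (hCS : ∀ p ∈ C, p.2 ∈ S) :
    (ν.prod (volume.restrict T)).restrict C = (ν.prod volume).restrict C := by
  have h := Measure.prod_restrict (μ := ν) (ν := (volume : Measure ℝ)) univ T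
  rw [Measure.restrict_univ] at h
  have hCT : C ⊆ univ ×ˢ T := fun p hp => ⟨mem_univ _, hST (hCS p hp)⟩
  rw [h, Measure.restrict_restrict hC, inter_eq_left.2 hCT]

variable {Ω E : Type*} [MeasurableSpace Ω] [NormedAddCommGroup E] [InnerProductSpace ℝ E]
  [FiniteDimensional ℝ E] [SecondCountableTopology E] [MeasurableSpace E] [BorelSpace E]

variable {P : Measure Ω} [IsProbabilityMeasure P] {M : Ω → Measure (E × ℝ)} {ν : Measure E}
  [SFinite ν] {S T : Set ℝ} {f : ℝ → E →L[ℝ] E}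

lemma truncatedPoissonIntegral_eq {Ω : Type*} {M : Ω → Measure (E × ℝ)} (hS : MeasurableSet S) (hST : S ⊆ T) (hf : Measurable f)
    (ε : ℝ) (ω : Ω) :
    truncatedPoissonIntegral M ν S f ε ω =
      ((∫ p in {p : E × ℝ | p ∈ Prod.snd ⁻¹' S ∧ ε < ‖f p.2 p.1‖}, f p.2 p.1 ∂(M ω))
        - ∫ p in {p : E × ℝ | p ∈ Prod.snd ⁻¹' S ∧ ε < ‖f p.2 p.1‖ ∧ ‖f p.2 p.1‖ ≤ 1},
            f p.2 p.1 ∂(ν.prod (volume.restrict T)))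
      + ∫ s in S, driftChange ν (f s) := by
  rw [prod_time_restrict hST (measurableSet_jumps_Ioc (measurable_snd hS)
    (measurable_eval_kernel hf) ε 1) fun p hp => hp.1]
  rfl

lemma PoissonIntegrable.lintegral_lt_top (h : PoissonIntegrable ν S f) (hS : MeasurableSet S)
    (hST : S ⊆ T) (hf : Measurable f) :
    ∫⁻ p in Prod.snd ⁻¹' S, min 1 (‖f p.2 p.1‖ₑ ^ 2) ∂(ν.prod (volume.restrict T)) < ∞ := by
  rw [setLIntegral_prod_time hS hST
    (measurable_const.min ((measurable_eval_kernel hf).enorm.pow_const 2))]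
  exact h.jumps

lemma PoissonIntegrable.exists_isPoissonIntegral
    (hM : IsPoissonRandomMeasure P M (ν.prod (volume.restrict T)))
    (h : PoissonIntegrable ν S f) (hS : MeasurableSet S) (hST : S ⊆ T) (hf : Measurable f) :
    ∃ Y : Ω → E, IsPoissonIntegral P M ν S f Y := by
  have : CompleteSpace E := FiniteDimensional.complete ℝ E
  obtain ⟨Y, hYm, hY⟩ := hM.exists_tendstoInMeasure_truncated (measurable_snd hS)
    (measurable_eval_kernel hf) (h.lintegral_lt_top hS hST hf)
  refine ⟨fun ω => Y ω + ∫ s in S, driftChange ν (f s), h, hYm.add_const _, ?_⟩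
  simp_rw [funext fun ε => funext fun ω =>
    truncatedPoissonIntegral_eq (M := M) (ν := ν) hS hST hf ε ω]
  simpa only [TendstoInMeasure, edist_add_right] using hY

lemma PoissonIntegrable.isPoissonIntegral_poissonIntegral
    (hM : IsPoissonRandomMeasure P M (ν.prod (volume.restrict T)))
    (h : PoissonIntegrable ν S f) (hS : MeasurableSet S) (hST : S ⊆ T) (hf : Measurable f) :
    IsPoissonIntegral P M ν S f (poissonIntegral P M ν S f) := by
  have hex := h.exists_isPoissonIntegral hM hS hST hf
  rw [poissonIntegral, dif_pos hex]
  exact hex.choose_spec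

/-- One `η` each goes to the distance from `Y` to its truncation, to the truncated integral without
drift, and to the drift. The first contribution vanishes as `ε ↓ 0`. -/
lemma IsPoissonIntegral.measure_ge_le {Y : Ω → E} (hY : IsPoissonIntegral P M ν S f Y)
    (hM : IsPoissonRandomMeasure P M (ν.prod (volume.restrict T)))
    (hS : MeasurableSet S) (hST : S ⊆ T) (hf : Measurable f) {η : ℝ≥0∞} (hη : η ≠ 0)
    (hη' : η ≠ ∞) (hb : ∫⁻ s in S, ‖driftChange ν (f s)‖ₑ < η) :
    P {ω | 3 * η ≤ ‖Y ω‖ₑ} ≤ (∫⁻ s in S, ∫⁻ z, min 1 (‖f s z‖ₑ ^ 2) ∂ν) +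
      (∫⁻ s in S, ∫⁻ z, min 1 (‖f s z‖ₑ ^ 2) ∂ν) / η ^ 2 := by
  have : CompleteSpace E := FiniteDimensional.complete ℝ E
  set J := ∫⁻ s in S, ∫⁻ z, min 1 (‖f s z‖ₑ ^ 2) ∂ν
  have hJ : ∫⁻ p in Prod.snd ⁻¹' S, min 1 (‖f p.2 p.1‖ₑ ^ 2)
      ∂(ν.prod (volume.restrict T)) = J :=
    setLIntegral_prod_time hS hST
      (measurable_const.min ((measurable_eval_kernel hf).enorm.pow_const 2))
  have hb' : ‖∫ s in S, driftChange ν (f s)‖ₑ < η :=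
    (enorm_integral_le_lintegral_enorm _).trans_lt hb
  have hlim := (hY.tendsto η hη.bot_lt).add_const (J + J / η ^ 2)
  rw [zero_add] at hlim
  refine ge_of_tendsto hlim ?_
  filter_upwards [Ioc_mem_nhdsGT (one_pos : (0 : ℝ) < 1)] with ε hε
  have hbound := hM.measure_truncated_ge_le (measurable_snd hS) (measurable_eval_kernel hf)
    (hJ.trans_lt hY.integrable.jumps) hε.1 hε.2 hη hη'
  rw [hJ] at hbound
  refine le_trans (measure_mono fun ω hω => ?_)
    ((measure_union_le _ _).trans (add_le_add le_rfl hbound))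
  by_contra hcon
  simp only [mem_union, mem_ofPred_eq, not_or, not_le] at hcon hω
  obtain ⟨h1, h2⟩ := hcon
  rw [truncatedPoissonIntegral_eq hS hST hf, edist_comm, edist_eq_enorm_sub] at h1
  refine absurd hω (not_le.2 ?_)
  have hsum : (3 : ℝ≥0∞) * η = η + η + η := by ring
  rw [hsum]
  refine lt_of_le_of_lt ?_ (ENNReal.add_lt_add (ENNReal.add_lt_add h1 h2) hb')
  refine le_trans (le_of_eq ?_) ((enorm_add_le _ _).trans (add_le_add (enorm_add_le _ _) le_rfl))
  congr 1
  abel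

lemma tendstoInMeasure_poissonIntegral_zero {ι : Type*} {l : Filter ι}
    {M : ι → Ω → Measure (E × ℝ)} {ν : ι → Measure E} [∀ i, SFinite (ν i)] {S : ι → Set ℝ}
    {Y : ι → Ω → E} (hY : ∀ i, IsPoissonIntegral P (M i) (ν i) (S i) f (Y i))
    (hM : ∀ i, IsPoissonRandomMeasure P (M i) ((ν i).prod (volume.restrict T)))
    (hS : ∀ i, MeasurableSet (S i)) (hST : ∀ i, S i ⊆ T) (hf : Measurable f)
    (hJ : Tendsto (fun i => ∫⁻ s in S i, ∫⁻ z, min 1 (‖f s z‖ₑ ^ 2) ∂(ν i)) l (𝓝 0))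
    (hb : Tendsto (fun i => ∫⁻ s in S i, ‖driftChange (ν i) (f s)‖ₑ) l (𝓝 0)) :
    TendstoInMeasure P Y l (fun _ => 0) := by
  refine tendstoInMeasure_of_ne_top fun δ hδ hδ' => ?_
  have hη : δ / 3 ≠ 0 := (ENNReal.div_pos hδ.ne' (by simp)).ne'
  have hη' : δ / 3 ≠ ∞ := (ENNReal.div_lt_top hδ' (by simp)).ne
  have hlim := hJ.add (ENNReal.Tendsto.div_const hJ (b := (δ / 3) ^ 2)
    (.inr (pow_ne_zero 2 hη)))
  rw [ENNReal.zero_div, add_zero] at hlim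
  refine tendsto_of_tendsto_of_tendsto_of_le_of_le' tendsto_const_nhds hlim
    (.of_forall fun _ => bot_le) ?_
  filter_upwards [hb.eventually (Iio_mem_nhds hη.bot_lt)] with i hi
  have := (hY i).measure_ge_le (hM i) (hS i) (hST i) hf hη hη' hi
  rw [ENNReal.mul_div_cancel (by simp) (by simp)] at this
  simpa only [edist_zero_right] using this

end PoissonIntegral

/-! ### The drift as a function of the kernel -/

section DriftChange

variable {E : Type*} [NormedAddCommGroup E] [NormedSpace ℝ E]

/-- The two indicators differ in two cases. If `‖A z‖ ≤ 1 < ‖z‖`, the difference has norm at most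
`1`; if `‖z‖ ≤ 1 < ‖A z‖`, then `‖A z‖ ≤ ‖A z‖² ≤ ‖A‖² ‖z‖²`. -/
lemma norm_sub_indicator_le (A : E →L[ℝ] E) (z : E) :
    ‖{z : E | ‖A z‖ ≤ 1}.indicator (fun z => A z) z
      - {z : E | ‖z‖ ≤ 1}.indicator (fun z => A z) z‖ ≤ (1 + ‖A‖ ^ 2) * min 1 (‖z‖ ^ 2) := by
  have hA := A.le_opNorm z
  have hpos : 0 ≤ (1 + ‖A‖ ^ 2) * min 1 (‖z‖ ^ 2) := by positivity
  by_cases h1 : ‖A z‖ ≤ 1 <;> by_cases h2 : ‖z‖ ≤ 1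
  · simpa [indicator, h1, h2] using hpos
  · have h3 : 1 ≤ ‖z‖ ^ 2 := one_le_pow₀ (not_le.1 h2).le
    simp only [indicator, mem_ofPred_eq, h1, h2, if_true, if_false, sub_zero, min_eq_left h3]
    nlinarith [sq_nonneg ‖A‖]
  · have h3 : ‖z‖ ^ 2 ≤ 1 := pow_le_one₀ (norm_nonneg _) h2
    simp only [indicator, mem_ofPred_eq, h1, h2, if_true, if_false, zero_sub, norm_neg,
      min_eq_right h3]
    have h4 : ‖A z‖ ^ 2 ≤ (‖A‖ * ‖z‖) ^ 2 := by gcongr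
    nlinarith [sq_nonneg ‖z‖]
  · simpa [indicator, h1, h2] using hpos

end DriftChange

lemma enorm_indicator_norm_gt_one_le {E : Type*} [NormedAddCommGroup E] [NormedSpace ℝ E]
    (A : E →L[ℝ] E) (z : E) :
    ‖{z : E | 1 < ‖A z‖}.indicator (fun z => A z) z‖ₑ ≤ ‖A‖ₑ ^ 2 * ‖z‖ₑ ^ 2 := by
  by_cases h : 1 < ‖A z‖
  · rw [indicator_of_mem (show z ∈ {z : E | 1 < ‖A z‖} from h)]
    have h1 : 1 ≤ ‖A z‖ₑ := by
      rw [← ofReal_norm, ENNReal.one_le_ofReal]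
      exact h.le
    calc ‖A z‖ₑ ≤ ‖A z‖ₑ ^ 2 := by
          rw [sq]
          exact le_mul_of_one_le_left bot_le h1
      _ ≤ (‖A‖ₑ * ‖z‖ₑ) ^ 2 := by
          gcongr
          exact A.le_opENorm z
      _ = _ := mul_pow _ _ _
  · rw [indicator_of_notMem (show z ∉ {z : E | 1 < ‖A z‖} from h)]
    simp

lemma enorm_integral_norm_gt_one_le {E : Type*} [NormedAddCommGroup E] [NormedSpace ℝ E]
    [MeasurableSpace E] {ν : Measure E} :
    ‖∫ z, {z : E | 1 < ‖z‖}.indicator id z ∂ν‖ₑ ≤ ∫⁻ z, ‖z‖ₑ ^ 2 ∂ν := by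
  refine (enorm_integral_le_lintegral_enorm _).trans (lintegral_mono fun z => ?_)
  refine (enorm_indicator_norm_gt_one_le (ContinuousLinearMap.id ℝ E) z).trans ?_
  refine mul_le_of_le_one_left bot_le (pow_le_one₀ bot_le ?_)
  rw [← ofReal_norm]
  exact ENNReal.ofReal_le_one.2 ContinuousLinearMap.norm_id_le

section DriftChangeMeasure

variable {E : Type*} [NormedAddCommGroup E] [NormedSpace ℝ E] [SecondCountableTopology E]
  [MeasurableSpace E] [BorelSpace E]

lemma integrable_sub_indicator {ν : Measure E} (hν : ∫⁻ z, min 1 (‖z‖ₑ ^ 2) ∂ν < ∞)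
    (A : E →L[ℝ] E) :
    Integrable (fun z => {z : E | ‖A z‖ ≤ 1}.indicator (fun z => A z) z
      - {z : E | ‖z‖ ≤ 1}.indicator (fun z => A z) z) ν := by
  have hA : Measurable fun z => A z := A.measurable
  have hmin : Integrable (fun z : E => min 1 (‖z‖ ^ 2)) ν := by
    refine ⟨(by fun_prop : Measurable fun z : E => min 1 (‖z‖ ^ 2)).aestronglyMeasurable, ?_⟩
    refine lt_of_le_of_lt (lintegral_mono fun z => ?_) hν
    rw [Real.enorm_eq_ofReal (by positivity), ← ofReal_norm z,
      ← ENNReal.ofReal_pow (norm_nonneg _), ← ENNReal.ofReal_one, ← ENNReal.ofReal_min]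
  refine (hmin.const_mul (1 + ‖A‖ ^ 2)).mono' ?_ (.of_forall fun z => norm_sub_indicator_le A z)
  exact ((hA.indicator (measurableSet_le hA.norm measurable_const)).sub
    (hA.indicator (measurableSet_le measurable_norm measurable_const))).aestronglyMeasurable

lemma driftChange_add {ν₁ ν₂ : Measure E} (h₁ : ∫⁻ z, min 1 (‖z‖ₑ ^ 2) ∂ν₁ < ∞)
    (h₂ : ∫⁻ z, min 1 (‖z‖ₑ ^ 2) ∂ν₂ < ∞) (A : E →L[ℝ] E) :
    driftChange (ν₁ + ν₂) A = driftChange ν₁ A + driftChange ν₂ A :=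
  integral_add_measure (integrable_sub_indicator h₁ A) (integrable_sub_indicator h₂ A)

lemma measurable_driftChange [SecondCountableTopology (E →L[ℝ] E)] {ν : Measure E} [SFinite ν]
    {f : ℝ → E →L[ℝ] E} (hf : Measurable f) : Measurable fun s => driftChange ν (f s) := by
  have hfz := measurable_eval_kernel hf
  have h : Measurable fun p : E × ℝ =>
      {p : E × ℝ | ‖f p.2 p.1‖ ≤ 1}.indicator (fun p => f p.2 p.1) p
        - {p : E × ℝ | ‖p.1‖ ≤ 1}.indicator (fun p => f p.2 p.1) p :=
    (hfz.indicator (measurableSet_le hfz.norm measurable_const)).sub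
      (hfz.indicator (measurableSet_le measurable_fst.norm measurable_const))
  exact (h.stronglyMeasurable.integral_prod_left' (μ := ν)).measurable

/-- If `ν` has a second moment, then `driftChange ν` is linear up to a quadratic error. -/
lemma enorm_driftChange_sub_le [CompleteSpace E] {ν : Measure E}
    (hν : ∫⁻ z, ‖z‖ₑ ^ 2 ∂ν < ∞) (A : E →L[ℝ] E) :
    ‖driftChange ν A - A (∫ z, {z : E | 1 < ‖z‖}.indicator id z ∂ν)‖ₑ
      ≤ ‖A‖ₑ ^ 2 * ∫⁻ z, ‖z‖ₑ ^ 2 ∂ν := by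
  have hA : Measurable fun z => A z := A.measurable
  have hlevy : ∫⁻ z, min 1 (‖z‖ₑ ^ 2) ∂ν < ∞ :=
    (lintegral_mono fun z => min_le_right _ _).trans_lt hν
  have hid : Integrable (fun z : E => {z : E | 1 < ‖z‖}.indicator id z) ν := by
    refine ⟨(measurable_id.indicator (measurableSet_lt measurable_const
      measurable_norm)).aestronglyMeasurable, lt_of_le_of_lt (lintegral_mono fun z => ?_) hν⟩
    refine (enorm_indicator_norm_gt_one_le (ContinuousLinearMap.id ℝ E) z).trans ?_
    refine mul_le_of_le_one_left bot_le (pow_le_one₀ bot_le ?_)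
    rw [← ofReal_norm]
    exact ENNReal.ofReal_le_one.2 ContinuousLinearMap.norm_id_le
  -- The two terms cut by `‖z‖` add up to `A z`, so only the part with `‖A z‖ > 1` survives, and
  -- there `‖A z‖ ≤ ‖A z‖²`.
  have hpt : ∀ z, {z : E | ‖A z‖ ≤ 1}.indicator (fun z => A z) z
      - {z : E | ‖z‖ ≤ 1}.indicator (fun z => A z) z - A ({z : E | 1 < ‖z‖}.indicator id z) =
      -{z : E | 1 < ‖A z‖}.indicator (fun z => A z) z := by
    intro z
    by_cases h1 : ‖A z‖ ≤ 1 <;> by_cases h2 : ‖z‖ ≤ 1 <;>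
      simp [indicator, h1, h2, not_lt.2, not_le.1]
  rw [driftChange, ← A.integral_comp_comm hid,
    ← integral_sub (integrable_sub_indicator hlevy A) (A.integrable_comp hid)]
  simp_rw [hpt]
  refine (enorm_integral_le_lintegral_enorm _).trans ?_
  simp_rw [enorm_neg]
  rw [← lintegral_const_mul _ (by fun_prop)]
  exact lintegral_mono fun z => enorm_indicator_norm_gt_one_le A z

/-- On the vectors `c` for which `f(·) c` is integrable, the `L¹` norm of `f(·) c` is bounded by a
multiple of the norm of `c`. -/
lemma exists_lintegral_enorm_apply_le [FiniteDimensional ℝ E] {α : Type*} [MeasurableSpace α]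
    {ρ : Measure α} {f : α → E →L[ℝ] E} (hf : Measurable f) :
    ∃ C : ℝ≥0, ∀ c : E, ∫⁻ s, ‖f s c‖ₑ ∂ρ < ∞ → ∫⁻ s, ‖f s c‖ₑ ∂ρ ≤ C * ‖c‖ₑ := by
  let V : Submodule ℝ E :=
    { carrier := {c | Integrable (fun s => f s c) ρ}
      add_mem' := fun {a b} ha hb => by
        have := Integrable.add (show Integrable (fun s => f s a) ρ from ha) hb
        refine this.congr (.of_forall fun s => ?_)
        simp
      zero_mem' := by simp
      smul_mem' := fun r a ha => by
        have := Integrable.smul r (show Integrable (fun s => f s a) ρ from ha)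
        refine this.congr (.of_forall fun s => ?_)
        simp }
  let Φ : V →ₗ[ℝ] (α →₁[ρ] E) :=
    { toFun := fun c => Integrable.toL1 (fun s => f s (c : E)) c.2
      map_add' := fun a b => by
        rw [← Integrable.toL1_add]
        congr 1
        ext s
        simp
      map_smul' := fun r a => by
        rw [RingHom.id_apply, ← Integrable.toL1_smul']
        congr 1
        ext s
        simp }
  -- Continuity is automatic because `V` is finite dimensional; `C` is the operator norm.
  let Ψ : V →L[ℝ] (α →₁[ρ] E) := LinearMap.toContinuousLinearMap Φ
  refine ⟨‖Ψ‖₊, fun c hc => ?_⟩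
  have hcV : Integrable (fun s => f s c) ρ :=
    ⟨(hf.apply_continuousLinearMap c).aestronglyMeasurable, hc⟩
  have h := Ψ.le_opENorm ⟨c, hcV⟩
  have e : ‖Ψ ⟨c, hcV⟩‖ₑ = ∫⁻ s, ‖f s c‖ₑ ∂ρ := Integrable.enorm_toL1 hcV
  rw [e] at h
  exact h

/-- The quadratic error is at most `F * K`, with `K` the second moment of `ν m`. The linear part
`f(·) c` is in `L¹` because the drift and the error are, so its norm is at most `C ‖c‖ ≤ C * K`. -/
lemma tendsto_lintegral_driftChange_zero [FiniteDimensional ℝ E] {ν : ℕ → Measure E}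
    [∀ m, SFinite (ν m)]
    {ρ : Measure ℝ} {f : ℝ → E →L[ℝ] E} (hf : Measurable f)
    (hν : Tendsto (fun m => ∫⁻ z, ‖z‖ₑ ^ 2 ∂(ν m)) atTop (𝓝 0))
    (hf2 : ∫⁻ s, ‖f s‖ₑ ^ 2 ∂ρ < ∞)
    (hb : ∀ m, ∫⁻ s, ‖driftChange (ν m) (f s)‖ₑ ∂ρ < ∞) :
    Tendsto (fun m => ∫⁻ s, ‖driftChange (ν m) (f s)‖ₑ ∂ρ) atTop (𝓝 0) := by
  have : CompleteSpace E := FiniteDimensional.complete ℝ E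
  obtain ⟨C, hC⟩ := exists_lintegral_enorm_apply_le (ρ := ρ) hf
  set F := ∫⁻ s, ‖f s‖ₑ ^ 2 ∂ρ
  have hlim : Tendsto (fun m => (C + F) * ∫⁻ z, ‖z‖ₑ ^ 2 ∂(ν m)) atTop (𝓝 0) := by
    have := ENNReal.Tendsto.const_mul hν (a := C + F) (.inr (by finiteness))
    rwa [mul_zero] at this
  refine tendsto_of_tendsto_of_tendsto_of_le_of_le' tendsto_const_nhds hlim
    (.of_forall fun _ => bot_le) ?_
  filter_upwards [hν.eventually (Iio_mem_nhds ENNReal.zero_lt_top)] with m hm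
  set K := ∫⁻ z, ‖z‖ₑ ^ 2 ∂(ν m)
  set c := ∫ z, {z : E | 1 < ‖z‖}.indicator id z ∂(ν m)
  have hfn : Measurable fun s => ‖f s‖ₑ ^ 2 * K := (hf.enorm.pow_const 2).mul_const _
  have hdm : Measurable fun s => ‖driftChange (ν m) (f s)‖ₑ := (measurable_driftChange hf).enorm
  have hfc : Measurable fun s => ‖f s c‖ₑ := (hf.apply_continuousLinearMap c).enorm
  have hint : ∫⁻ s, ‖f s‖ₑ ^ 2 * K ∂ρ = F * K := lintegral_mul_const _ (hf.enorm.pow_const 2)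
  have h1 : ∫⁻ s, ‖f s c‖ₑ ∂ρ ≤ (∫⁻ s, ‖driftChange (ν m) (f s)‖ₑ ∂ρ) + F * K := by
    rw [← hint, ← lintegral_add_left hdm]
    refine lintegral_mono fun s => ?_
    calc ‖f s c‖ₑ = ‖driftChange (ν m) (f s) - (driftChange (ν m) (f s) - f s c)‖ₑ := by
          rw [sub_sub_cancel]
      _ ≤ _ := (enorm_sub_le).trans (add_le_add le_rfl (enorm_driftChange_sub_le hm (f s)))
  have h2 : ∫⁻ s, ‖f s c‖ₑ ∂ρ < ∞ :=
    h1.trans_lt (ENNReal.add_lt_top.2 ⟨hb m, ENNReal.mul_lt_top hf2 hm⟩)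
  calc ∫⁻ s, ‖driftChange (ν m) (f s)‖ₑ ∂ρ
      ≤ ∫⁻ s, (‖f s c‖ₑ + ‖f s‖ₑ ^ 2 * K) ∂ρ := by
        refine lintegral_mono fun s => ?_
        calc ‖driftChange (ν m) (f s)‖ₑ
            = ‖f s c + (driftChange (ν m) (f s) - f s c)‖ₑ := by rw [add_sub_cancel]
          _ ≤ _ := (enorm_add_le _ _).trans
            (add_le_add le_rfl (enorm_driftChange_sub_le hm (f s)))
    _ = (∫⁻ s, ‖f s c‖ₑ ∂ρ) + F * K := by rw [lintegral_add_left hfc, hint]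
    _ ≤ C * K + F * K := by
        gcongr
        exact (hC c h2).trans (by gcongr; exact enorm_integral_norm_gt_one_le)
    _ = (C + F) * K := by ring

lemma lintegral_lintegral_min_le {ν : Measure E} {ρ : Measure ℝ} {f : ℝ → E →L[ℝ] E}
    (hf : Measurable f) :
    ∫⁻ s, ∫⁻ z, min 1 (‖f s z‖ₑ ^ 2) ∂ν ∂ρ ≤ (∫⁻ s, ‖f s‖ₑ ^ 2 ∂ρ) * ∫⁻ z, ‖z‖ₑ ^ 2 ∂ν := by
  rw [← lintegral_mul_const _ (hf.enorm.pow_const 2)]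
  refine lintegral_mono fun s => ?_
  rw [← lintegral_const_mul _ (by fun_prop)]
  refine lintegral_mono fun z => (min_le_right _ _).trans ?_
  rw [← mul_pow]
  gcongr
  exact (f s).le_opENorm z

end DriftChangeMeasure

/-! ### Tails in time, and joint convergence in probability -/

lemma tendsto_setLIntegral_diff_zero {α : Type*} [MeasurableSpace α] {ρ : Measure α}
    {T : Set α} {S : ℕ → Set α} (hS : Monotone S) (hSm : ∀ n, MeasurableSet (S n))
    (hST : ⋃ n, S n = T) {G : α → ℝ≥0∞} (hG : ∫⁻ s in T, G s ∂ρ < ∞) :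
    Tendsto (fun n => ∫⁻ s in T \ S n, G s ∂ρ) atTop (𝓝 0) := by
  have hT : MeasurableSet T := hST ▸ MeasurableSet.iUnion hSm
  -- Continuity from above for the measure with density `G`, which is finite on `T`.
  have h := tendsto_measure_iInter_atTop (μ := ρ.withDensity G) (s := fun n => T \ S n)
    (fun n => (hT.diff (hSm n)).nullMeasurableSet) (fun m n hmn => sdiff_subset_sdiff_right (hS hmn))
    ⟨0, (lt_of_le_of_lt (measure_mono sdiff_subset) (by rwa [withDensity_apply _ hT])).ne⟩
  have he : ⋂ n, T \ S n = ∅ := by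
    rw [← sdiff_iUnion, hST, sdiff_self]
  rw [he, measure_empty] at h
  refine h.congr fun n => ?_
  rw [Function.comp_apply, withDensity_apply _ (hT.diff (hSm n))]

/-- A union bound, as the distance in a finite product is the maximum over the coordinates. Thus
finite dimensional convergence reduces to single times. -/
lemma tendstoInMeasure_pi_const {Ω ι κ E : Type*} [MeasurableSpace Ω] [Fintype κ]
    [PseudoEMetricSpace E] {P : Measure Ω} {l : Filter ι} {Z : ι → κ → Ω → E} {W : κ → Ω → E}
    (h : ∀ i, TendstoInMeasure P (fun j => Z j i) l (W i)) :
    TendstoInMeasure P (fun j ω i => Z j i ω) l (fun ω i => W i ω) := by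
  intro ε hε
  have hsum : Tendsto (fun j => ∑ i, P {ω | ε ≤ edist (Z j i ω) (W i ω)}) l (𝓝 0) := by
    have := tendsto_finsetSum Finset.univ fun i _ => h i ε hε
    simpa using this
  refine tendsto_of_tendsto_of_tendsto_of_le_of_le tendsto_const_nhds hsum
    (fun _ => bot_le) fun j => ?_
  refine (measure_mono fun ω hω => ?_).trans (measure_iUnion_fintype_le P _)
  have hω' : ε ≤ edist (fun i => Z j i ω) (fun i => W i ω) := hω
  rw [edist_pi_def, Finset.le_sup_iff hε] at hω'
  obtain ⟨i, -, hi⟩ := hω'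
  exact mem_iUnion.2 ⟨i, hi⟩

/-! ### Shot noise measures -/

section ShotNoise

variable {Ω 𝒰 E : Type*} [MeasurableSpace Ω] [MeasurableSpace 𝒰] [NormedAddCommGroup E]
  [MeasurableSpace E] {P : Measure Ω} [IsProbabilityMeasure P] {U : Ω → 𝒰} {H : ℝ → 𝒰 → E}

instance sFinite_shotNoiseMeasure (J : Set ℝ) : SFinite (shotNoiseMeasure P U H J) := by
  unfold shotNoiseMeasure
  infer_instance

lemma measurable_shotNoise {E : Type*} [MeasurableSpace E] {H : ℝ → 𝒰 → E} (hU : Measurable U) (hH : Measurable fun p : ℝ × 𝒰 => H p.1 p.2) :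
    Measurable fun p : ℝ × Ω => H p.1 (U p.2) :=
  hH.comp (measurable_fst.prodMk (hU.comp measurable_snd))

lemma shotNoiseMeasure_union (hU : Measurable U) (hH : Measurable fun p : ℝ × 𝒰 => H p.1 p.2)
    {I J : Set ℝ} (hIJ : Disjoint I J) (hJ : MeasurableSet J) :
    shotNoiseMeasure P U H (I ∪ J) = shotNoiseMeasure P U H I + shotNoiseMeasure P U H J := by
  rw [shotNoiseMeasure, Measure.restrict_union hIJ hJ, Measure.add_prod,
    Measure.map_add _ _ (measurable_shotNoise hU hH), Measure.restrict_add]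
  rfl

lemma lintegral_shotNoiseMeasure_le [OpensMeasurableSpace E] (hU : Measurable U)
    (hH : Measurable fun p : ℝ × 𝒰 => H p.1 p.2) (J : Set ℝ) :
    ∫⁻ z, ‖z‖ₑ ^ 2 ∂(shotNoiseMeasure P U H J) ≤ ∫⁻ r in J, ∫⁻ ω, ‖H r (U ω)‖ₑ ^ 2 ∂P := by
  have hm := measurable_shotNoise hU hH
  refine (setLIntegral_le_lintegral _ _).trans ?_
  rw [lintegral_map (by fun_prop) hm, lintegral_prod _ (by fun_prop)]

end ShotNoise

/-! ### The proposition -/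

theorem proposition1 {d : ℕ} {Ω 𝒰 : Type*} [MeasurableSpace Ω] [MeasurableSpace 𝒰]
    (P : Measure Ω) [IsProbabilityMeasure P]
    -- the shot noise decomposition of the Lévy measure `ν`, where `H(r, u)` is used for `r > 0`
    (U : Ω → 𝒰) (hU : Measurable U)
    (H : ℝ → 𝒰 → EuclideanSpace ℝ (Fin d)) (hH : Measurable (fun p : ℝ × 𝒰 => H p.1 p.2))
    (hHanti : ∀ u, AntitoneOn (fun r => ‖H r u‖) (Ioi 0))
    (ν : Measure (EuclideanSpace ℝ (Fin d))) (hν : IsLevyMeasure ν)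
    (hνH : ν = shotNoiseMeasure P U H (Ioi 0))
    -- the time domain and its truncations
    (𝒯 : Set ℝ) (𝒯n : ℕ → Set ℝ) (h𝒯mono : Monotone 𝒯n) (h𝒯conn : ∀ n, (𝒯n n).OrdConnected)
    (h𝒯fin : ∀ n, volume (𝒯n n) < ∞) (h𝒯 : ⋃ n, 𝒯n n = 𝒯)
    -- the Poisson random measure `μ`, and its parts `μm m = μ_m` and `μr m = μ - μ_m`
    (μ : Ω → Measure (EuclideanSpace ℝ (Fin d) × ℝ))
    (μm μr : ℕ → Ω → Measure (EuclideanSpace ℝ (Fin d) × ℝ))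
    (hμ : IsPoissonRandomMeasure P μ (ν.prod (volume.restrict 𝒯)))
    (hμm : ∀ m : ℕ, IsPoissonRandomMeasure P (μm m)
      ((shotNoiseMeasure P U H (Ioc 0 (m : ℝ))).prod (volume.restrict 𝒯)))
    (hμr : ∀ m : ℕ, IsPoissonRandomMeasure P (μr m)
      ((shotNoiseMeasure P U H (Ioi (m : ℝ))).prod (volume.restrict 𝒯)))
    (hμsum : ∀ m, ∀ᵐ ω ∂P, μ ω = μm m ω + μr m ω)
    -- the kernel
    (T : ℝ) (f : ℝ → ℝ → EuclideanSpace ℝ (Fin d) →L[ℝ] EuclideanSpace ℝ (Fin d))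
    (hf : ∀ t ∈ Icc 0 T, Measurable (f t))
    -- the stochastic integrals exist
    (hQ : ∀ m : ℕ, ∀ t ∈ Icc 0 T,
      PoissonIntegrable (shotNoiseMeasure P U H (Ioi (m : ℝ))) 𝒯 (f t))
    (hR : ∀ m n : ℕ, ∀ t ∈ Icc 0 T,
      PoissonIntegrable (shotNoiseMeasure P U H (Ioc 0 (m : ℝ))) (𝒯 \ 𝒯n n) (f t))
    -- (a), (b), (c)
    (ha : ∀ t ∈ Icc 0 T, essSup (fun s => ‖f t s‖ₑ) (volume.restrict 𝒯) < ∞)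
    (hb : ∀ t ∈ Icc 0 T, ∫⁻ s in 𝒯, ‖f t s‖ₑ ^ 2 < ∞)
    (hc : Tendsto (fun m : ℕ => ∫⁻ r in Ioi (m : ℝ), ∫⁻ ω, ‖H r (U ω)‖ₑ ^ 2 ∂P) atTop (𝓝 0)) :
    let Q : ℕ → ℝ → Ω → EuclideanSpace ℝ (Fin d) := fun m t =>
      poissonIntegral P (μr m) (shotNoiseMeasure P U H (Ioi (m : ℝ))) 𝒯 (f t)
    let R : ℕ × ℕ → ℝ → Ω → EuclideanSpace ℝ (Fin d) := fun p t =>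
      poissonIntegral P (μm p.1) (shotNoiseMeasure P U H (Ioc 0 (p.1 : ℝ))) (𝒯 \ 𝒯n p.2) (f t)
    -- the processes are well defined
    (∀ m : ℕ, ∀ t ∈ Icc 0 T, IsPoissonIntegral P (μr m)
      (shotNoiseMeasure P U H (Ioi (m : ℝ))) 𝒯 (f t) (Q m t)) ∧
    (∀ m n : ℕ, ∀ t ∈ Icc 0 T, IsPoissonIntegral P (μm m)
      (shotNoiseMeasure P U H (Ioc 0 (m : ℝ))) (𝒯 \ 𝒯n n) (f t) (R (m, n) t)) ∧
    -- and converge to the zero process as `m ∧ n → ∞`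
    TendstoInFDD P (Icc 0 T) Q atTop (fun _ _ => 0) ∧
    TendstoInFDD P (Icc 0 T) R (comap (fun p : ℕ × ℕ => min p.1 p.2) atTop) (fun _ _ => 0) := by
  classical
  intro Q R
  let E := EuclideanSpace ℝ (Fin d)
  let νm : ℕ → Measure E := fun m => shotNoiseMeasure P U H (Ioc 0 (m : ℝ))
  let νr : ℕ → Measure E := fun m => shotNoiseMeasure P U H (Ioi (m : ℝ))
  have h𝒯n : ∀ n, MeasurableSet (𝒯n n) := fun n => (h𝒯conn n).measurableSet
  have h𝒯m : MeasurableSet 𝒯 := h𝒯 ▸ MeasurableSet.iUnion h𝒯n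
  have hSm : ∀ n, MeasurableSet (𝒯 \ 𝒯n n) := fun n => h𝒯m.diff (h𝒯n n)
  have hQint : ∀ m : ℕ, ∀ t ∈ Icc 0 T, IsPoissonIntegral P (μr m) (νr m) 𝒯 (f t) (Q m t) :=
    fun m t ht => (hQ m t ht).isPoissonIntegral_poissonIntegral (hμr m) h𝒯m subset_rfl (hf t ht)
  have hRint : ∀ m n : ℕ, ∀ t ∈ Icc 0 T,
      IsPoissonIntegral P (μm m) (νm m) (𝒯 \ 𝒯n n) (f t) (R (m, n) t) :=
    fun m n t ht =>
      (hR m n t ht).isPoissonIntegral_poissonIntegral (hμm m) (hSm n) sdiff_subset (hf t ht)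
  have hadd : ∀ m : ℕ, ν = νm m + νr m := fun m => by
    rw [hνH, ← Ioc_union_Ioi_eq_Ioi (Nat.cast_nonneg (α := ℝ) m),
      shotNoiseMeasure_union hU hH (Ioc_disjoint_Ioi le_rfl) measurableSet_Ioi]
  have hle : ∀ m : ℕ, νm m ≤ ν := fun m => hadd m ▸ Measure.le_add_right le_rfl
  have hle' : ∀ m : ℕ, νr m ≤ ν := fun m => hadd m ▸ Measure.le_add_left le_rfl
  have hν0 : νr 0 = ν := by simp only [νr, Nat.cast_zero, hνH]
  have hdrift : ∀ m : ℕ, ∀ A : E →L[ℝ] E,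
      driftChange ν A = driftChange (νm m) A + driftChange (νr m) A := fun m A => by
    rw [← driftChange_add ((lintegral_mono' (hle m) le_rfl).trans_lt hν.lintegral_lt_top)
      ((lintegral_mono' (hle' m) le_rfl).trans_lt hν.lintegral_lt_top), ← hadd m]
  have hK : Tendsto (fun m => ∫⁻ z, ‖z‖ₑ ^ 2 ∂(νr m)) atTop (𝓝 0) :=
    tendsto_of_tendsto_of_tendsto_of_le_of_le tendsto_const_nhds hc (fun _ => bot_le)
      fun m => lintegral_shotNoiseMeasure_le hU hH _
  have hbr : ∀ t ∈ Icc 0 T,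
      Tendsto (fun m => ∫⁻ s in 𝒯, ‖driftChange (νr m) (f t s)‖ₑ) atTop (𝓝 0) := fun t ht =>
    tendsto_lintegral_driftChange_zero (hf t ht) hK (hb t ht) fun m => (hQ m t ht).drift
  have hQlim : ∀ t ∈ Icc 0 T, TendstoInMeasure P (fun m => Q m t) atTop (fun _ => 0) := by
    intro t ht
    refine tendstoInMeasure_poissonIntegral_zero (fun m => hQint m t ht) hμr (fun _ => h𝒯m)
      (fun _ => subset_rfl) (hf t ht) ?_ (hbr t ht)
    have hlim := ENNReal.Tendsto.const_mul hK (.inr (hb t ht).ne)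
    rw [mul_zero] at hlim
    exact tendsto_of_tendsto_of_tendsto_of_le_of_le tendsto_const_nhds hlim (fun _ => bot_le)
      fun m => lintegral_lintegral_min_le (hf t ht)
  have hfst : Tendsto Prod.fst (comap (fun p : ℕ × ℕ => min p.1 p.2) atTop) atTop :=
    tendsto_atTop_mono (fun p => min_le_left p.1 p.2) tendsto_comap
  have hsnd : Tendsto Prod.snd (comap (fun p : ℕ × ℕ => min p.1 p.2) atTop) atTop :=
    tendsto_atTop_mono (fun p => min_le_right p.1 p.2) tendsto_comap
  have hRlim : ∀ t ∈ Icc 0 T, TendstoInMeasure P (fun p => R p t)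
      (comap (fun p : ℕ × ℕ => min p.1 p.2) atTop) (fun _ => 0) := by
    intro t ht
    -- At `m = 0` the remainder measure is all of `ν`, so this is the existence of `X_t`; it makes
    -- the jump and drift integrals for `ν` finite over `𝒯`, and hence their tails small.
    have hint := hQ 0 t ht
    rw [show shotNoiseMeasure P U H (Ioi ((0 : ℕ) : ℝ)) = ν from hν0] at hint
    refine tendstoInMeasure_poissonIntegral_zero (fun p => hRint p.1 p.2 t ht)
      (fun p => hμm p.1) (fun p => hSm p.2) (fun _ => sdiff_subset) (hf t ht) ?_ ?_
    · exact tendsto_of_tendsto_of_tendsto_of_le_of_le tendsto_const_nhds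
        ((tendsto_setLIntegral_diff_zero h𝒯mono h𝒯n h𝒯 hint.jumps).comp hsnd) (fun _ => bot_le)
        fun p => lintegral_mono fun s => lintegral_mono' (hle p.1) le_rfl
    · have hlim := ((tendsto_setLIntegral_diff_zero h𝒯mono h𝒯n h𝒯 hint.drift).comp hsnd).add
        ((hbr t ht).comp hfst)
      rw [add_zero] at hlim
      refine tendsto_of_tendsto_of_tendsto_of_le_of_le tendsto_const_nhds hlim (fun _ => bot_le)
        fun p => ?_
      calc ∫⁻ s in 𝒯 \ 𝒯n p.2, ‖driftChange (νm p.1) (f t s)‖ₑ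
          ≤ ∫⁻ s in 𝒯 \ 𝒯n p.2,
              (‖driftChange ν (f t s)‖ₑ + ‖driftChange (νr p.1) (f t s)‖ₑ) := by
            refine lintegral_mono fun s => ?_
            -- The drift is not monotone in the measure, so `νm ≤ ν` gives no bound here; additivity
            -- is used instead.
            rw [show driftChange (νm p.1) (f t s) =
              driftChange ν (f t s) - driftChange (νr p.1) (f t s) by rw [hdrift p.1]; abel]
            exact enorm_sub_le
        _ = (∫⁻ s in 𝒯 \ 𝒯n p.2, ‖driftChange ν (f t s)‖ₑ) +
              ∫⁻ s in 𝒯 \ 𝒯n p.2, ‖driftChange (νr p.1) (f t s)‖ₑ :=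
            lintegral_add_right _ (measurable_driftChange (hf t ht)).enorm
        _ ≤ _ := add_le_add le_rfl (lintegral_mono_set sdiff_subset)
  refine ⟨hQint, hRint, fun k t ht => ?_, fun k t ht => ?_⟩
  · exact (tendstoInMeasure_pi_const (Z := fun m i => Q m (t i)) (W := fun _ _ => 0)
      fun i => hQlim (t i) (ht i)).tendstoInDistribution_of_aemeasurable
      (fun m => aemeasurable_pi_lambda _ fun i => (hQint m (t i) (ht i)).aemeasurable)
      aemeasurable_const
  · exact (tendstoInMeasure_pi_const (Z := fun p i => R p (t i)) (W := fun _ _ => 0)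
      fun i => hRlim (t i) (ht i)).tendstoInDistribution_of_aemeasurable
      (fun p => aemeasurable_pi_lambda _ fun i => (hRint p.1 p.2 (t i) (ht i)).aemeasurable)
      aemeasurable_const
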